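/- A *graph* $G=(V,E)$ consists of finite sets $V,E$ and a map $\mathrm{ends}\colon E\to\{\text{subsets of }V\text{ of size }1\text{ or }2\}$ (loops and parallel edges are allowed); an edge is a *loop* if it has one endpoint. *Branch width.* A branch decomposition of $G$ is a pair $(Y,b)$ of a finite tree $Y$ in which each node has at most three neighbours and a bijection $b$ from the leaves of $Y$ (the nodes with exactly one neighbour) to $E$. Removing an edge $e$ of $Y$ splits the leaves, hence $E$, into two parts $A_e,B_e$; the order of $e$ is $|\mathrm{ends}(A_e)\cap\mathrm{ends}(B_e)|$. The width of $(Y,b)$ is the maximal order of an edge of $Y$ ($0$ if $Y$ has no edge), and the branch width $\mathrm{bw}(G)$ is the minimal width of a branch decomposition of $G$ (with $\mathrm{bw}(G)=0$ if $G$ has exactly one edge, in which case there is no branch decomposition). *Monoidal width.* Let $\mathcal C$ be the monoidal category whose objects are finite sets and whose morphisms $X\to Y$ are isomorphism classes of cospans $X\to H\leftarrow Y$, that is, graphs $H$ with functions from $X$ and from $Y$ to the vertices of $H$; composition is by pushout (glueing of vertices along the common set) and the monoidal product $\otimes$ is disjoint union. A monoidal decomposition of a morphism $f$ is a binary tree whose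 leaves are labelled by morphisms of $\mathcal C$, whose inner nodes are labelled by $\otimes$ or by composition along an object $X$, and which evaluates to $f$. The weight of a leaf is the number of vertices of the apex $H$ of its label, the weight of a node "composition along $X$" is $|X|$, and the weight of a node $\otimes$ is $0$. The width of a decomposition is the maximal weight of its nodes, and the monoidal width $\mathrm{mwd}(f)$ is the minimal width of a monoidal decomposition of $f$. **Theorem.** Let $G$ be a graph and let $g=(\emptyset\to G\leftarrow\emptyset)$ be the corresponding morphism of $\mathcal C$. Then $$\tfrac12\,\mathrm{bw}(G)\;\le\;\mathrm{mwd}(g),$$ and, unless $\mathrm{bw}(G)=0$ and $G$ has an edge that is not a loop, $$\mathrm{mwd}(g)\;\le\;\mathrm{bw}(G)+1 .$$ In the excepted case, $\mathrm{mwd}(g)=2$. -/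

import Mathlib

open CategoryTheory MonoidalCategory

universe v u

/-! ## Monoidal decompositions and monoidal width in a monoidal category -/

/-- The monoidal decompositions of a morphism `f`, for a class `atoms` of atomic morphisms:
binary trees whose leaves are atomic morphisms, whose inner nodes are labelled `⊗` or
`≫` along an object, and whose value is `f`. -/
inductive MonoidalDecomposition {C : Type u} [Category.{v} C] [MonoidalCategory C]
    (atoms : MorphismProperty C) : {A B : C} → (A ⟶ B) → Type (max u v)
  | leaf {A B : C} (f : A ⟶ B) (hf : atoms f) : MonoidalDecomposition atoms f
  | tensor {A₁ B₁ A₂ B₂ : C} {f₁ : A₁ ⟶ B₁} {f₂ : A₂ ⟶ B₂}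
      (d₁ : MonoidalDecomposition atoms f₁) (d₂ : MonoidalDecomposition atoms f₂) :
      MonoidalDecomposition atoms (f₁ ⊗ₘ f₂)
  | comp {A B : C} (X : C) {f₁ : A ⟶ X} {f₂ : X ⟶ B}
      (d₁ : MonoidalDecomposition atoms f₁) (d₂ : MonoidalDecomposition atoms f₂) :
      MonoidalDecomposition atoms (f₁ ≫ f₂)

/-- A weight function: a weight for each object `X` (the cost of composing along `X`), additive
on monoidal products, and a weight for each atomic morphism. The operation `⊗` has weight `0`. -/
structure WeightFunction (C : Type u) [Category.{v} C] [MonoidalCategory C]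
    (atoms : MorphismProperty C) where
  obj : C → ℕ
  mor : {A B : C} → (f : A ⟶ B) → atoms f → ℕ
  obj_tensor : ∀ X Y : C, obj (X ⊗ Y) = obj X + obj Y

namespace MonoidalDecomposition

/-- The width of a decomposition: the weight of its most expensive node. -/
def width {C : Type u} [Category.{v} C] [MonoidalCategory C] {atoms : MorphismProperty C}
    (w : WeightFunction C atoms) :
    {A B : C} → {f : A ⟶ B} → MonoidalDecomposition atoms f → ℕ
  | _, _, _, leaf f hf => w.mor f hf
  | _, _, _, tensor d₁ d₂ => max (width w d₁) (width w d₂)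
  | _, _, _, comp X d₁ d₂ => max (width w d₁) (max (w.obj X) (width w d₂))

end MonoidalDecomposition

/-- The monoidal width of a morphism: the least width of a monoidal decomposition of it. -/
noncomputable def monoidalWidth {C : Type u} [Category.{v} C] [MonoidalCategory C]
    {atoms : MorphismProperty C} (w : WeightFunction C atoms) {A B : C} (f : A ⟶ B) : ℕ :=
  sInf (Set.range fun d : MonoidalDecomposition atoms f => d.width w)

/-! ## Graphs and branch width -/

/-- A finite undirected graph (loops and parallel edges are allowed). An element of `Sym2 V` is a
set of one or two vertices. -/
structure UGraph where
  V : Type u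
  E : Type u
  [finV : Finite V]
  [finE : Finite E]
  ends : E → Sym2 V

attribute [instance] UGraph.finV UGraph.finE

namespace UGraph

/-- The endpoints of a set of edges. -/
def endpoints (G : UGraph.{u}) (S : Set G.E) : Set G.V :=
  {v | ∃ e ∈ S, v ∈ G.ends e}

/-- A branch decomposition: a finite subcubic tree together with a bijection from its leaves
(the nodes with exactly one neighbour) to the edges of the graph. -/
structure BranchDecomposition (G : UGraph.{u}) where
  Node : Type u
  [finNode : Finite Node]
  tree : SimpleGraph Node
  isTree : tree.IsTree
  subcubic : ∀ n, (tree.neighborSet n).ncard ≤ 3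
  leafEquiv : {n : Node // (tree.neighborSet n).ncard = 1} ≃ G.E

namespace BranchDecomposition

variable {G : UGraph.{u}}

/-- The edges of `G` that label the leaves on the side of `a`, once the edge `ab` of the tree is
removed. -/
def side (D : G.BranchDecomposition) (a b : D.Node) : Set G.E :=
  {e | (D.tree.deleteEdges {s(a, b)}).Reachable a (D.leafEquiv.symm e).1}

/-- The order of the edge `ab` of the tree. -/
noncomputable def order (D : G.BranchDecomposition) (a b : D.Node) : ℕ :=
  (G.endpoints (D.side a b) ∩ G.endpoints (D.side b a)).ncard

/-- The maximal order of an edge of the tree (each edge is listed once in each direction, with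
the same order); it is `0` if the tree has no edge. -/
noncomputable def width (D : G.BranchDecomposition) : ℕ :=
  ⨆ d : D.tree.Dart, D.order d.fst d.snd

end BranchDecomposition

/-- Branch width. A graph with exactly one edge has no branch decomposition (no tree has exactly
one leaf); its branch width is `0`, by the usual convention, which `sInf ∅ = 0` provides. -/
noncomputable def branchWidth (G : UGraph.{u}) : ℕ :=
  sInf (Set.range fun D : G.BranchDecomposition => D.width)

end UGraph

/-! ## The monoidal category of cospans of graphs over discrete graphs -/

/-- A cospan of graphs between the discrete graphs on `X` and `Y`. A homomorphism from a discrete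
graph is a function to the vertices. -/
structure GraphCospan (X Y : Type u) where
  apex : UGraph.{u}
  left : X → apex.V
  right : Y → apex.V

namespace GraphCospan

variable {X Y Z W : Type u}

/-- Isomorphism of cospans: an isomorphism of the apices that commutes with the legs. -/
def IsoRel (f g : GraphCospan X Y) : Prop :=
  ∃ (φ : f.apex.V ≃ g.apex.V) (ψ : f.apex.E ≃ g.apex.E),
    (∀ e, g.apex.ends (ψ e) = (f.apex.ends e).map φ) ∧
    (∀ x, φ (f.left x) = g.left x) ∧ (∀ y, φ (f.right y) = g.right y)

instance setoid (X Y : Type u) : Setoid (GraphCospan X Y) where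
  r := IsoRel
  iseqv :=
    { refl := fun f => ⟨Equiv.refl _, Equiv.refl _, by simp, by simp, by simp⟩
      symm := by
        rintro f g ⟨φ, ψ, he, hl, hr⟩
        refine ⟨φ.symm, ψ.symm, fun e => ?_, fun x => ?_, fun y => ?_⟩
        · have := he (ψ.symm e)
          rw [Equiv.apply_symm_apply] at this
          rw [this, Sym2.map_map]
          simp
        · rw [← hl, Equiv.symm_apply_apply]
        · rw [← hr, Equiv.symm_apply_apply]
      trans := by
        rintro f g h ⟨φ, ψ, he, hl, hr⟩ ⟨φ', ψ', he', hl', hr'⟩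
        refine ⟨φ.trans φ', ψ.trans ψ', fun e => ?_, fun x => ?_, fun y => ?_⟩
        · simp [he, he', Sym2.map_map]
        · simp [hl, hl']
        · simp [hr, hr'] }

/-- The cospan given by a function: its left leg is the function and its right leg the identity. -/
def ofFun [Finite Y] (f : X → Y) : GraphCospan X Y where
  apex := { V := Y, E := PEmpty, ends := fun e => e.elim }
  left := f
  right := id

/-- The relation that generates the glueing of the vertices in a composite. -/
inductive Glue (f : GraphCospan X Y) (g : GraphCospan Y Z) : f.apex.V ⊕ g.apex.V →
    f.apex.V ⊕ g.apex.V → Prop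
  | mk (y : Y) : Glue f g (Sum.inl (f.right y)) (Sum.inr (g.left y))

/-- The vertices of the pushout. -/
abbrev CompV (f : GraphCospan X Y) (g : GraphCospan Y Z) : Type u := Quot (Glue f g)

/-- Composition by pushout: the vertices are glued along `Y`, the edges are kept. -/
def comp (f : GraphCospan X Y) (g : GraphCospan Y Z) : GraphCospan X Z where
  apex :=
    { V := CompV f g
      E := f.apex.E ⊕ g.apex.E
      ends := Sum.elim
        (fun e => (f.apex.ends e).map fun v => Quot.mk _ (Sum.inl v))
        (fun e => (g.apex.ends e).map fun v => Quot.mk _ (Sum.inr v)) }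
  left := fun x => Quot.mk _ (Sum.inl (f.left x))
  right := fun z => Quot.mk _ (Sum.inr (g.right z))

/-- Monoidal product by disjoint union. -/
def tensor {X' Y' : Type u} (f : GraphCospan X Y) (g : GraphCospan X' Y') :
    GraphCospan (X ⊕ X') (Y ⊕ Y') where
  apex :=
    { V := f.apex.V ⊕ g.apex.V
      E := f.apex.E ⊕ g.apex.E
      ends := Sum.elim (fun e => (f.apex.ends e).map Sum.inl)
        (fun e => (g.apex.ends e).map Sum.inr) }
  left := Sum.map f.left g.left
  right := Sum.map f.right g.right

theorem map_square {α β γ δ : Type u} (p : α → β) (q : β → δ) (p' : α → γ) (q' : γ → δ)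
    (h : ∀ a, q (p a) = q' (p' a)) (s : Sym2 α) : (s.map p).map q = (s.map p').map q' := by
  rw [Sym2.map_map, Sym2.map_map, show q ∘ p = q' ∘ p' from funext h]

theorem map_square₁ {α β γ δ : Type u} (p : α → β) (p' : α → γ) (q' : γ → δ) (r : δ → β)
    (h : ∀ a, p a = r (q' (p' a))) (s : Sym2 α) :
    s.map p = ((s.map p').map q').map r := by
  rw [Sym2.map_map, Sym2.map_map, show p = (r ∘ q') ∘ p' from funext h]

theorem map_square₂ {α β γ δ ε : Type u} (p : α → β) (q : β → δ) (p' : α → γ) (q' : γ → ε)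
    (r : ε → δ) (h : ∀ a, q (p a) = r (q' (p' a))) (s : Sym2 α) :
    (s.map p).map q = ((s.map p').map q').map r := by
  rw [Sym2.map_map, Sym2.map_map, Sym2.map_map, show q ∘ p = (r ∘ q') ∘ p' from funext h]

theorem map_retract {α β : Type u} (p : α → β) (q : β → α)
    (h : ∀ a, q (p a) = a) (s : Sym2 α) : (s.map p).map q = s := by
  rw [Sym2.map_map, show q ∘ p = id from funext h, Sym2.map_id, id]

theorem glue_eq (f : GraphCospan X Y) (g : GraphCospan Y Z) (y : Y) :
    (Quot.mk _ (Sum.inl (f.right y)) : CompV f g) = Quot.mk _ (Sum.inr (g.left y)) :=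
  Quot.sound (Glue.mk y)

/-- Maps out of the pushout. -/
def desc {T : Type u} (f : GraphCospan X Y) (g : GraphCospan Y Z) (a : f.apex.V → T)
    (b : g.apex.V → T) (h : ∀ y, a (f.right y) = b (g.left y)) : CompV f g → T :=
  Quot.lift (Sum.elim a b) (by rintro _ _ ⟨y⟩; exact h y)

theorem comp_congr {f f' : GraphCospan X Y} {g g' : GraphCospan Y Z} (hf : f ≈ f')
    (hg : g ≈ g') : f.comp g ≈ f'.comp g' := by
  obtain ⟨φ, ψ, he, hl, hr⟩ := hf
  obtain ⟨φ', ψ', he', hl', hr'⟩ := hg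
  refine ⟨⟨desc f g (fun v => Quot.mk _ (Sum.inl (φ v))) (fun v => Quot.mk _ (Sum.inr (φ' v)))
      (fun y => by rw [hr, hl']; exact glue_eq f' g' y),
    desc f' g' (fun v => Quot.mk _ (Sum.inl (φ.symm v)))
      (fun v => Quot.mk _ (Sum.inr (φ'.symm v)))
      (fun y => by 
        rw [← hr, ← hl', Equiv.symm_apply_apply, Equiv.symm_apply_apply]
        exact glue_eq f g y), ?_, ?_⟩,
    ψ.sumCongr ψ', ?_, ?_, ?_⟩
  · rintro ⟨v | v⟩
    · exact congrArg (fun t => (Quot.mk _ (Sum.inl t) : CompV f g)) (φ.symm_apply_apply v)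
    · exact congrArg (fun t => (Quot.mk _ (Sum.inr t) : CompV f g)) (φ'.symm_apply_apply v)
  · rintro ⟨v | v⟩
    · exact congrArg (fun t => (Quot.mk _ (Sum.inl t) : CompV f' g')) (φ.apply_symm_apply v)
    · exact congrArg (fun t => (Quot.mk _ (Sum.inr t) : CompV f' g')) (φ'.apply_symm_apply v)
  · rintro (e | e)
    · exact (congrArg (Sym2.map _) (he e)).trans (map_square _ _ _ _ (by intro _; rfl) _)
    · exact (congrArg (Sym2.map _) (he' e)).trans (map_square _ _ _ _ (by intro _; rfl) _)
  · intro x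
    exact congrArg (fun t => (Quot.mk _ (Sum.inl t) : CompV f' g')) (hl x)
  · intro x
    exact congrArg (fun t => (Quot.mk _ (Sum.inr t) : CompV f' g')) (hr' x)

theorem tensor_congr {X' Y' : Type u} {f f' : GraphCospan X Y} {g g' : GraphCospan X' Y'}
    (hf : f ≈ f') (hg : g ≈ g') : f.tensor g ≈ f'.tensor g' := by
  obtain ⟨φ, ψ, he, hl, hr⟩ := hf
  obtain ⟨φ', ψ', he', hl', hr'⟩ := hg
  refine ⟨φ.sumCongr φ', ψ.sumCongr ψ', ?_, ?_, ?_⟩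
  · rintro (e | e)
    · exact (congrArg (Sym2.map _) (he e)).trans (map_square _ _ _ _ (by intro _; rfl) _)
    · exact (congrArg (Sym2.map _) (he' e)).trans (map_square _ _ _ _ (by intro _; rfl) _)
  · rintro (x | x)
    · exact congrArg Sum.inl (hl x)
    · exact congrArg Sum.inr (hl' x)
  · rintro (x | x)
    · exact congrArg Sum.inl (hr x)
    · exact congrArg Sum.inr (hr' x)

theorem ofFun_comp [Finite Y] (a : X → Y) (g : GraphCospan Y Z) :
    (ofFun a).comp g ≈ ⟨g.apex, g.left ∘ a, g.right⟩ := by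
  refine ⟨⟨desc (ofFun a) g g.left id (fun y => rfl), fun v => Quot.mk _ (Sum.inr v), ?_, ?_⟩,
    Equiv.emptySum PEmpty _, ?_, ?_, ?_⟩
  · rintro ⟨v | v⟩
    · exact (glue_eq (ofFun a) g v).symm
    · rfl
  · intro v; rfl
  · rintro (e | e)
    · exact e.elim
    · exact (map_retract _ _ (by intro _; rfl) _).symm
  · intro x; rfl
  · intro x; rfl

theorem comp_ofFun [Finite Z] (f : GraphCospan X Y) (b : Y ≃ Z) :
    f.comp (ofFun b) ≈ ⟨f.apex, f.left, f.right ∘ b.symm⟩ := by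
  refine ⟨⟨desc f (ofFun b) id (f.right ∘ b.symm) (fun y => by simp [ofFun]),
      fun v => Quot.mk _ (Sum.inl v), ?_, ?_⟩,
    Equiv.sumEmpty _ PEmpty, ?_, ?_, ?_⟩
  · rintro ⟨v | v⟩
    · rfl
    · have := glue_eq f (ofFun b) (b.symm v)
      exact this.trans (congrArg (fun t => (Quot.mk _ (Sum.inr t) : CompV f (ofFun b)))
        (b.apply_symm_apply v))
  · intro v; rfl
  · rintro (e | e)
    · exact (map_retract _ _ (by intro _; rfl) _).symm
    · exact e.elim
  · intro x; rfl
  · intro x; rfl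

theorem ofFun_tensor {X' Y' : Type u} [Finite Y] [Finite Y'] (a : X → Y) (b : X' → Y') :
    (ofFun a).tensor (ofFun b) ≈ ofFun (Sum.map a b) := by
  refine ⟨Equiv.refl _, Equiv.equivOfIsEmpty (PEmpty ⊕ PEmpty) PEmpty, ?_, ?_, ?_⟩
  · rintro (e | e) <;> exact e.elim
  · rintro (x | x) <;> rfl
  · rintro (x | x) <;> rfl

theorem comp_assoc (f : GraphCospan X Y) (g : GraphCospan Y Z) (h : GraphCospan Z W) :
    (f.comp g).comp h ≈ f.comp (g.comp h) := by
  refine ⟨⟨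
    desc (f.comp g) h
      (desc f g (fun v => Quot.mk _ (Sum.inl v))
        (fun v => Quot.mk _ (Sum.inr (Quot.mk _ (Sum.inl v))))
        (fun y => glue_eq f (g.comp h) y))
      (fun v => Quot.mk _ (Sum.inr (Quot.mk _ (Sum.inr v))))
      (fun z => congrArg (fun t => (Quot.mk _ (Sum.inr t) : CompV f (g.comp h)))
        (glue_eq g h z)),
    desc f (g.comp h)
      (fun v => Quot.mk _ (Sum.inl (Quot.mk _ (Sum.inl v))))
      (desc g h (fun v => Quot.mk _ (Sum.inl (Quot.mk _ (Sum.inr v))))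
        (fun v => Quot.mk _ (Sum.inr v))
        (fun z => glue_eq (f.comp g) h z))
      (fun y => congrArg (fun t => (Quot.mk _ (Sum.inl t) : CompV (f.comp g) h))
        (glue_eq f g y)), ?_, ?_⟩,
    Equiv.sumAssoc _ _ _, ?_, ?_, ?_⟩
  · rintro ⟨⟨⟨v | v⟩⟩ | v⟩ <;> rfl
  · rintro ⟨v | ⟨⟨v | v⟩⟩⟩ <;> rfl
  · rintro ((e | e) | e)
    · exact map_square₁ _ _ _ _ (by intro _; rfl) _
    · exact map_square₂ _ _ _ _ _ (by intro _; rfl) _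
    · exact map_square _ _ _ _ (by intro _; rfl) _
  · intro x; rfl
  · intro x; rfl

theorem tensor_comp_tensor {X' Y' Z' : Type u} (f : GraphCospan X Y) (f' : GraphCospan X' Y')
    (g : GraphCospan Y Z) (g' : GraphCospan Y' Z') :
    (f.tensor f').comp (g.tensor g') ≈ (f.comp g).tensor (f'.comp g') := by
  refine ⟨⟨
    desc (f.tensor f') (g.tensor g')
      (Sum.map (fun v => Quot.mk _ (Sum.inl v)) (fun v => Quot.mk _ (Sum.inl v)))
      (Sum.map (fun v => Quot.mk _ (Sum.inr v)) (fun v => Quot.mk _ (Sum.inr v)))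
      (by
        rintro (y | y)
        · exact congrArg Sum.inl (glue_eq f g y)
        · exact congrArg Sum.inr (glue_eq f' g' y)),
    Sum.elim
      (desc f g (fun v => Quot.mk _ (Sum.inl (Sum.inl v)))
        (fun v => Quot.mk _ (Sum.inr (Sum.inl v)))
        (fun y => glue_eq (f.tensor f') (g.tensor g') (Sum.inl y)))
      (desc f' g' (fun v => Quot.mk _ (Sum.inl (Sum.inr v)))
        (fun v => Quot.mk _ (Sum.inr (Sum.inr v)))
        (fun y => glue_eq (f.tensor f') (g.tensor g') (Sum.inr y))), ?_, ?_⟩,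
    Equiv.sumSumSumComm _ _ _ _, ?_, ?_, ?_⟩
  · rintro ⟨(v | v) | (v | v)⟩ <;> rfl
  · rintro (⟨⟨v | v⟩⟩ | ⟨⟨v | v⟩⟩) <;> rfl
  · rintro ((e | e) | (e | e)) <;> exact map_square₂ _ _ _ _ _ (by intro _; rfl) _
  · rintro (x | x) <;> rfl
  · rintro (x | x) <;> rfl

end GraphCospan

/-- The objects of the category of cospans of graphs: finite sets, seen as discrete graphs. -/
structure DiscreteGraph where
  carrier : Type u
  [fin : Finite carrier]

attribute [instance] DiscreteGraph.fin

namespace DiscreteGraph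

/-- Morphisms are isomorphism classes of cospans of graphs. -/
def Hom (X Y : DiscreteGraph.{u}) : Type (u + 1) :=
  Quotient (GraphCospan.setoid X.carrier Y.carrier)

/-- The morphism represented by a cospan. -/
def Hom.mk {X Y : DiscreteGraph.{u}} (f : GraphCospan X.carrier Y.carrier) : Hom X Y :=
  Quotient.mk _ f

instance : Category.{u + 1} DiscreteGraph.{u} where
  Hom := Hom
  id X := Hom.mk (GraphCospan.ofFun id)
  comp := Quotient.map₂ GraphCospan.comp fun _ _ hf _ _ hg => GraphCospan.comp_congr hf hg
  id_comp := by
    rintro X Y ⟨f⟩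
    exact Quotient.sound (GraphCospan.ofFun_comp id f)
  comp_id := by
    rintro X Y ⟨f⟩
    exact Quotient.sound (GraphCospan.comp_ofFun f (Equiv.refl _))
  assoc := by
    rintro X Y Z W ⟨f⟩ ⟨g⟩ ⟨h⟩
    exact Quotient.sound (GraphCospan.comp_assoc f g h)

/-- The morphism represented by a cospan. -/
def homMk {X Y : DiscreteGraph.{u}} (f : GraphCospan X.carrier Y.carrier) : X ⟶ Y := Hom.mk f

/-- The morphism given by a function. -/
def homOfFun {X Y : DiscreteGraph.{u}} (a : X.carrier → Y.carrier) : X ⟶ Y :=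
  homMk (GraphCospan.ofFun a)

theorem homOfFun_id (X : DiscreteGraph.{u}) : 𝟙 X = homOfFun id := rfl

theorem homOfFun_comp {X Y Z : DiscreteGraph.{u}} (a : X.carrier → Y.carrier)
    (b : Y.carrier → Z.carrier) : homOfFun a ≫ homOfFun b = homOfFun (b ∘ a) :=
  Quotient.sound (GraphCospan.ofFun_comp a (GraphCospan.ofFun b))

/-- The isomorphism given by a bijection. -/
def isoOfEquiv {X Y : DiscreteGraph.{u}} (a : X.carrier ≃ Y.carrier) : X ≅ Y where
  hom := homOfFun a
  inv := homOfFun a.symm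
  hom_inv_id := by rw [homOfFun_comp, homOfFun_id]; simp
  inv_hom_id := by rw [homOfFun_comp, homOfFun_id]; simp

/-- Disjoint union of objects. -/
def sum (X Y : DiscreteGraph.{u}) : DiscreteGraph.{u} := ⟨X.carrier ⊕ Y.carrier⟩

/-- Monoidal product of morphisms. -/
def homTensor {X Y X' Y' : DiscreteGraph.{u}} : (X ⟶ Y) → (X' ⟶ Y') → (sum X X' ⟶ sum Y Y') :=
  Quotient.map₂ GraphCospan.tensor fun _ _ hf _ _ hg => GraphCospan.tensor_congr hf hg

instance : MonoidalCategoryStruct DiscreteGraph.{u} where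
  tensorObj := sum
  tensorHom := homTensor
  whiskerLeft X _ _ f := homTensor (𝟙 X) f
  whiskerRight f X := homTensor f (𝟙 X)
  tensorUnit := ⟨PEmpty⟩
  associator X Y Z := isoOfEquiv (Equiv.sumAssoc X.carrier Y.carrier Z.carrier)
  leftUnitor X := isoOfEquiv (Equiv.emptySum PEmpty X.carrier)
  rightUnitor X := isoOfEquiv (Equiv.sumEmpty X.carrier PEmpty)

theorem homOfFun_tensor {X Y X' Y' : DiscreteGraph.{u}} (a : X.carrier → Y.carrier)
    (b : X'.carrier → Y'.carrier) :
    homOfFun a ⊗ₘ homOfFun b = homOfFun (X := X ⊗ X') (Y := Y ⊗ Y') (Sum.map a b) :=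
  Quotient.sound (GraphCospan.ofFun_tensor a b)

theorem comp_eq_homOfFun {X Y Z : DiscreteGraph.{u}} {f : X ⟶ Y} {g : Y ⟶ Z}
    {a : X.carrier → Y.carrier} {b : Y.carrier → Z.carrier} {c : X.carrier → Z.carrier}
    (hf : f = homOfFun a) (hg : g = homOfFun b) (h : ∀ x, b (a x) = c x) :
    f ≫ g = homOfFun c := by
  rw [hf, hg, homOfFun_comp, show b ∘ a = c from funext h]

instance : MonoidalCategory DiscreteGraph.{u} :=
  MonoidalCategory.ofTensorHom
    (id_tensorHom_id := fun X Y => by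
      exact (homOfFun_tensor id id).trans (congrArg homOfFun Sum.map_id_id))
    (id_tensorHom := fun _ _ _ _ => rfl)
    (tensorHom_id := fun _ _ => rfl)
    (tensorHom_comp_tensorHom := by
      rintro _ _ _ _ _ _ ⟨f₁⟩ ⟨f₂⟩ ⟨g₁⟩ ⟨g₂⟩
      exact Quotient.sound (GraphCospan.tensor_comp_tensor f₁ f₂ g₁ g₂))
    (associator_naturality := by
      rintro _ _ _ _ _ _ ⟨f₁⟩ ⟨f₂⟩ ⟨f₃⟩
      refine Quotient.sound (Setoid.trans (GraphCospan.comp_ofFun _ (Equiv.sumAssoc _ _ _))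
        (Setoid.trans ?_ (Setoid.symm (GraphCospan.ofFun_comp _ _))))
      refine ⟨Equiv.sumAssoc _ _ _, Equiv.sumAssoc _ _ _, ?_, ?_, ?_⟩
      · rintro ((e | e) | e)
        · exact GraphCospan.map_square₁ _ _ _ _ (by intro _; rfl) _
        · exact GraphCospan.map_square₂ _ _ _ _ _ (by intro _; rfl) _
        · exact GraphCospan.map_square _ _ _ _ (by intro _; rfl) _
      · rintro ((x | x) | x) <;> rfl
      · rintro (x | (x | x)) <;> rfl)
    (leftUnitor_naturality := by
      rintro _ _ ⟨f⟩
      refine Quotient.sound (Setoid.trans (GraphCospan.comp_ofFun _ (Equiv.emptySum PEmpty _))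
        (Setoid.trans ?_ (Setoid.symm (GraphCospan.ofFun_comp _ _))))
      refine ⟨Equiv.emptySum PEmpty _, Equiv.emptySum PEmpty _, ?_, ?_, ?_⟩
      · rintro (e | e)
        · exact e.elim
        · exact (GraphCospan.map_retract _ _ (by intro _; rfl) _).symm
      · rintro (x | x)
        · exact x.elim
        · rfl
      · intro x; rfl)
    (rightUnitor_naturality := by
      rintro _ _ ⟨f⟩
      refine Quotient.sound (Setoid.trans (GraphCospan.comp_ofFun _ (Equiv.sumEmpty _ PEmpty))
        (Setoid.trans ?_ (Setoid.symm (GraphCospan.ofFun_comp _ _))))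
      refine ⟨Equiv.sumEmpty _ PEmpty, Equiv.sumEmpty _ PEmpty, ?_, ?_, ?_⟩
      · rintro (e | e)
        · exact (GraphCospan.map_retract _ _ (by intro _; rfl) _).symm
        · exact e.elim
      · rintro (x | x)
        · rfl
        · exact x.elim
      · intro x; rfl)
    (pentagon := fun W X Y Z =>
      (comp_eq_homOfFun (homOfFun_tensor _ _)
        (comp_eq_homOfFun rfl (homOfFun_tensor _ _) (fun _ => rfl))
        (by rintro (((x | x) | x) | x) <;> rfl)).trans
      (comp_eq_homOfFun rfl rfl (fun _ => rfl)).symm)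
    (triangle := fun X Y =>
      (comp_eq_homOfFun rfl (homOfFun_tensor _ _)
        (by
          rintro ((x | x) | x)
          · rfl
          · exact PEmpty.elim x
          · rfl)).trans
      (homOfFun_tensor _ _).symm)

/-- The number of vertices of the apex. -/
noncomputable def apexCard {X Y : DiscreteGraph.{u}} : (X ⟶ Y) → ℕ :=
  Quotient.lift (fun f => Nat.card f.apex.V) fun _ _ ⟨φ, _⟩ => Nat.card_congr φ

/-- The weight function on cospans of graphs: every morphism is atomic, objects are weighted by
their cardinality and morphisms by the number of vertices of the apex. -/
noncomputable def weight :
    WeightFunction DiscreteGraph.{u} (⊤ : MorphismProperty DiscreteGraph.{u}) where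
  obj X := Nat.card X.carrier
  mor f _ := apexCard f
  obj_tensor X Y := Nat.card_sum (α := X.carrier) (β := Y.carrier)

end DiscreteGraph

/-- The morphism `∅ → G ← ∅` given by a graph. -/
def UGraph.toHom (G : UGraph.{u}) :
    𝟙_ DiscreteGraph.{u} ⟶ 𝟙_ DiscreteGraph.{u} :=
  DiscreteGraph.homMk ⟨G, fun x => PEmpty.elim x, fun x => PEmpty.elim x⟩

/-! ## Components of a tree after the removal of an edge -/

namespace SimpleGraph

variable {N : Type*} {T : SimpleGraph N}

/-! Both inequalities go through a recursive form of branch decompositions, `BranchDecomposable`: a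
set of edges is split into disjoint parts, down to single edges, and every set that occurs has at
most `k` boundary vertices. The branch width is the least `k` for which the whole edge set is
decomposable in this sense. To read a tree recursively, orient a tree edge: the branch behind it is
a node together with the at most two branches behind that node. Conversely, a recursion is a rooted
binary tree; each tree edge comes with a set of nodes that it alone leaves, and this set shows both
that the edge is a bridge and what its order is.

Upper bound (`BranchDecomposable.pieceWidthLE`): a decomposable set `A` yields a morphism from its
boundary to `∅` whose apex is the part of `G` spanned by `A`. For a disjoint union, the boundary of
`A ∪ B` is first led past the piece of `A`, which is bent so that it outputs the vertices it shares
with the boundary of `B`; the remaining boundary vertices run in parallel with it. The result is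
composed with the piece of `B` along the boundary of `B`. Bending copies interface vertices one at a
time and so needs one spare vertex, hence the `+ 1`. A single edge costs its number of endpoints,
which exceeds `k + 1` only for a non-loop with `k = 0`.

Lower bound (`exists_cospan_branchDecomposable`): every subterm `X ⟶ Y` of a monoidal decomposition
of `G` occupies a part of `G` that is attached to the rest only along `X` and `Y`, so its edges have
at most `|X| + |Y|` boundary vertices. In a decomposition of width `w` of a closed morphism both
numbers are at most `w`, so the term is a recursive branch decomposition of width `2 * w`. In the
excepted case, some leaf must contain a non-loop and hence two vertices. -/

theorem Reachable.mem_of_closed {U : Set N} (hU : ∀ x ∈ U, ∀ y, T.Adj x y → y ∈ U) {a n : N}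
    (h : T.Reachable a n) (ha : a ∈ U) : n ∈ U := by
  obtain ⟨p⟩ := h
  induction p with
  | nil => exact ha
  | cons hadj _ ih => exact ih (hU _ ha _ hadj)

/-- If `ab` is the only edge that leaves `U`, then the component of `a` after removal of `ab` is
contained in `U`. -/
theorem reachable_deleteEdges_subset {U : Set N} {a b : N} (ha : a ∈ U)
    (hU : ∀ x ∈ U, ∀ y ∉ U, T.Adj x y → s(x, y) = s(a, b)) {n : N}
    (h : (T.deleteEdges {s(a, b)}).Reachable a n) : n ∈ U := by
  refine h.mem_of_closed (fun x hx y hxy => ?_) ha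
  rw [deleteEdges_adj] at hxy
  by_contra hy
  exact hxy.2 (hU x hx y hy hxy.1)

/-- The nodes on the side of `a` once the edge `ab` is removed. -/
def branch (T : SimpleGraph N) (a b : N) : Set N :=
  {n | (T.deleteEdges {s(a, b)}).Reachable a n}

theorem self_mem_branch (a b : N) : a ∈ T.branch a b := Reachable.refl _

theorem mem_branch_of_adj {a b x y : N} (hx : x ∈ T.branch a b) (hxy : T.Adj x y)
    (h : s(x, y) ≠ s(a, b)) : y ∈ T.branch a b :=
  Reachable.trans hx (Adj.reachable (by rw [deleteEdges_adj]; exact ⟨hxy, h⟩))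

theorem branch_subset_of_closed {a b : N} {U : Set N} (ha : a ∈ U)
    (hU : ∀ x ∈ U, ∀ y, T.Adj x y → s(x, y) ≠ s(a, b) → y ∈ U) : T.branch a b ⊆ U := by
  intro n hn
  refine Reachable.mem_of_closed (fun x hx y hxy => ?_) hn ha
  rw [deleteEdges_adj] at hxy
  exact hU x hx y hxy.1 hxy.2

theorem IsAcyclic.notMem_branch (hT : T.IsAcyclic) {a b : N} (h : T.Adj a b) :
    b ∉ T.branch a b := isAcyclic_iff_forall_adj_isBridge.1 hT h

theorem Connected.branch_union_branch (hT : T.Connected) (a b : N) :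
    T.branch a b ∪ T.branch b a = Set.univ := by
  refine Set.eq_univ_of_forall fun n => ?_
  refine (hT.preconnected a n).mem_of_closed (fun x hx y hxy => ?_) (Or.inl (self_mem_branch a b))
  by_cases h : s(x, y) = s(a, b)
  · rcases Sym2.eq_iff.1 h with ⟨-, rfl⟩ | ⟨-, rfl⟩
    · exact Or.inr (self_mem_branch _ _)
    · exact Or.inl (self_mem_branch _ _)
  · rcases hx with hx | hx
    · exact Or.inl (mem_branch_of_adj hx hxy h)
    · exact Or.inr (mem_branch_of_adj hx hxy (by rwa [Sym2.eq_swap (a := b)]))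

theorem IsAcyclic.disjoint_branch_swap (hT : T.IsAcyclic) {a b : N} (h : T.Adj a b) :
    Disjoint (T.branch a b) (T.branch b a) := by
  rw [Set.disjoint_left]
  intro n hn hn'
  refine hT.notMem_branch h (Reachable.trans hn ?_)
  have := Reachable.symm hn'
  rwa [Sym2.eq_swap] at this

theorem IsAcyclic.branch_subset_branch (hT : T.IsAcyclic) {a b c : N} (hab : T.Adj a b)
    (hac : T.Adj a c) (hcb : c ≠ b) : T.branch c a ⊆ T.branch a b := by
  have hc : c ∈ T.branch a b := mem_branch_of_adj (self_mem_branch a b) hac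
    (by rw [Ne, Sym2.congr_right]; exact hcb)
  -- Membership in `T.branch c a` is carried along so that the walk never visits `a`; as `b` is
  -- outside `T.branch a b`, the edge `ab` cannot be crossed from either end.
  have hsub : T.branch c a ⊆ T.branch a b ∩ T.branch c a := by
    refine branch_subset_of_closed ⟨hc, self_mem_branch _ _⟩ fun x hx y hxy h => ⟨?_, ?_⟩
    · refine mem_branch_of_adj hx.1 hxy fun h' => ?_
      rcases Sym2.eq_iff.1 h' with ⟨rfl, -⟩ | ⟨rfl, -⟩
      · exact hT.notMem_branch hac.symm hx.2
      · exact hT.notMem_branch hab hx.1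
    · exact mem_branch_of_adj hx.2 hxy h
  exact fun n hn => (hsub hn).1

/-- The right-hand side contains `a` and can be left only through `ab`. This is the recursive
structure of a branch. -/
theorem branch_subset_iUnion (a b : N) :
    T.branch a b ⊆ {n | n = a ∨ ∃ c, T.Adj a c ∧ c ≠ b ∧ n ∈ T.branch c a} := by
  refine branch_subset_of_closed (Or.inl rfl) ?_
  rintro x (rfl | ⟨c, hac, hcb, hx⟩) y hxy h
  · refine Or.inr ⟨y, hxy, ?_, self_mem_branch _ _⟩
    rintro rfl
    exact h rfl
  · by_cases h' : s(x, y) = s(c, a)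
    · rcases Sym2.eq_iff.1 h' with ⟨rfl, rfl⟩ | ⟨rfl, rfl⟩
      · exact Or.inl rfl
      · exact Or.inr ⟨y, hac, hcb, self_mem_branch _ _⟩
    · exact Or.inr ⟨c, hac, hcb, mem_branch_of_adj hx hxy h'⟩

/-- Deleting the points of `T.branch c a` from `T.branch c' a` keeps `c'` and leaves a set that is
still closed under adjacency away from `c'a`, so nothing was deleted. -/
theorem IsAcyclic.disjoint_branch (hT : T.IsAcyclic) {a c c' : N} (hc : T.Adj a c)
    (hc' : T.Adj a c') (hne : c ≠ c') : Disjoint (T.branch c a) (T.branch c' a) := by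
  have hca := hT.notMem_branch hc.symm
  have hca' := hT.notMem_branch hc'.symm
  have hsub : T.branch c' a ⊆ T.branch c' a \ T.branch c a := by
    refine branch_subset_of_closed ⟨self_mem_branch _ _, fun h => ?_⟩ fun x hx y hxy h =>
      ⟨mem_branch_of_adj hx.1 hxy h, fun hy => hx.2 (mem_branch_of_adj hy hxy.symm fun h' => ?_)⟩
    · refine hca (mem_branch_of_adj h hc'.symm ?_)
      rw [Ne, Sym2.congr_left]
      exact hne.symm
    · rcases Sym2.eq_iff.1 h' with ⟨-, rfl⟩ | ⟨rfl, -⟩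
      · exact hca' hx.1
      · exact hca hy
  exact Set.disjoint_left.2 fun n hn hn' => (hsub hn').2 hn

theorem IsAcyclic.ncard_branch_lt [Finite N] (hT : T.IsAcyclic) {a b c : N} (hab : T.Adj a b)
    (hac : T.Adj a c) (hcb : c ≠ b) : (T.branch c a).ncard < (T.branch a b).ncard := by
  refine Set.ncard_lt_ncard ⟨hT.branch_subset_branch hab hac hcb, fun h => ?_⟩ (Set.toFinite _)
  exact hT.notMem_branch hac.symm (h (self_mem_branch a b))

end SimpleGraph

/-! ## Recursive branch decompositions -/

namespace UGraph

variable {G : UGraph.{u}}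

/-- The vertices shared by a set of edges and its complement. -/
def boundary (G : UGraph.{u}) (A : Set G.E) : Set G.V := G.endpoints A ∩ G.endpoints Aᶜ

theorem endpoints_mono {A B : Set G.E} (h : A ⊆ B) : G.endpoints A ⊆ G.endpoints B :=
  fun _ ⟨e, he, hv⟩ => ⟨e, h he, hv⟩

@[simp] theorem endpoints_empty : G.endpoints ∅ = ∅ := by
  ext v; simp [endpoints]

theorem endpoints_union (A B : Set G.E) :
    G.endpoints (A ∪ B) = G.endpoints A ∪ G.endpoints B := by
  ext v
  simp only [endpoints, Set.mem_ofPred_eq, Set.mem_union]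
  constructor
  · rintro ⟨e, he | he, hv⟩
    · exact Or.inl ⟨e, he, hv⟩
    · exact Or.inr ⟨e, he, hv⟩
  · rintro (⟨e, he, hv⟩ | ⟨e, he, hv⟩)
    · exact ⟨e, Or.inl he, hv⟩
    · exact ⟨e, Or.inr he, hv⟩

@[simp] theorem boundary_empty : G.boundary ∅ = ∅ := by simp [boundary]

@[simp] theorem boundary_univ : G.boundary Set.univ = ∅ := by simp [boundary]

/-- A set of edges is branch decomposable with width `k` if it can be split recursively into
single edges, along sets of edges with at most `k` boundary vertices. -/
inductive BranchDecomposable (G : UGraph.{u}) (k : ℕ) : Set G.E → Prop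
  | empty : BranchDecomposable G k ∅
  | single (e : G.E) (h : (G.boundary {e}).ncard ≤ k) : BranchDecomposable G k {e}
  | union {A B : Set G.E} (hd : Disjoint A B) (hA : BranchDecomposable G k A)
      (hB : BranchDecomposable G k B) (h : (G.boundary (A ∪ B)).ncard ≤ k) :
      BranchDecomposable G k (A ∪ B)

theorem BranchDecomposable.ncard_boundary_le {k : ℕ} {A : Set G.E}
    (h : G.BranchDecomposable k A) : (G.boundary A).ncard ≤ k := by
  cases h with
  | empty => simp
  | single e h => exact h
  | union _ _ _ h => exact h

/-- If all subsets of `A` have small boundary, then any recursive splitting will do. -/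
theorem branchDecomposable_of_forall_subset {k : ℕ} {A : Set G.E}
    (h : ∀ B ⊆ A, (G.boundary B).ncard ≤ k) : G.BranchDecomposable k A := by
  induction A, Set.toFinite A using Set.Finite.induction_on with
  | empty => exact .empty
  | @insert e B he _ ih =>
    rw [Set.insert_eq]
    refine .union (Set.disjoint_singleton_left.2 he) (.single e (h _ (by simp)))
      (ih fun C hC => h C (hC.trans (Set.subset_insert _ _))) (h _ ?_)
    rw [Set.insert_eq]

/-! ### From branch decompositions to recursive ones -/

namespace BranchDecomposition

theorem side_eq_preimage (D : G.BranchDecomposition) (a b : D.Node) :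
    D.side a b = (fun e => (D.leafEquiv.symm e).1) ⁻¹' D.tree.branch a b := rfl

theorem side_swap (D : G.BranchDecomposition) {a b : D.Node} (h : D.tree.Adj a b) :
    D.side b a = (D.side a b)ᶜ := by
  rw [side_eq_preimage, side_eq_preimage, ← Set.preimage_compl]
  congr 1
  exact (IsCompl.compl_eq ⟨D.isTree.isAcyclic.disjoint_branch_swap h,
    codisjoint_iff.2 (D.isTree.connected.branch_union_branch a b)⟩).symm

theorem ncard_boundary_side_le (D : G.BranchDecomposition) {a b : D.Node} (h : D.tree.Adj a b) :
    (G.boundary (D.side a b)).ncard ≤ D.width := by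
  have := D.finNode
  have : Finite D.tree.Dart := Finite.of_injective _ SimpleGraph.Dart.toProd_injective
  -- The supremum bounds its terms only because there are finitely many darts; an unbounded supremum
  -- in `ℕ` would be `0`.
  have := le_ciSup (f := fun d : D.tree.Dart => D.order d.fst d.snd)
    (Set.finite_range _).bddAbove ⟨(a, b), h⟩
  rw [boundary, ← D.side_swap h]
  exact this

/-- Induction on the size of the branch at `a`. Besides `b`, the node `a` has at most two
neighbours: none gives a single edge, one leaves the side unchanged, two split it. -/
theorem branchDecomposable_side (D : G.BranchDecomposition) {a b : D.Node}
    (h : D.tree.Adj a b) : G.BranchDecomposable D.width (D.side a b) := by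
  have := D.finNode
  have hac := D.isTree.isAcyclic
  induction hn : (D.tree.branch a b).ncard using Nat.strong_induction_on generalizing a b with
  | _ n ih =>
    subst hn
    have hstep : ∀ c, D.tree.Adj a c → c ≠ b → G.BranchDecomposable D.width (D.side c a) :=
      fun c hc hcb => ih _ (hac.ncard_branch_lt h hc hcb) hc.symm rfl
    have hbd := D.ncard_boundary_side_le h
    have hb : b ∈ D.tree.neighborSet a := h
    by_cases hleaf : (D.tree.neighborSet a).ncard = 1
    · obtain ⟨x, hx⟩ := Set.ncard_eq_one.1 hleaf
      have hside : D.side a b = {D.leafEquiv ⟨a, hleaf⟩} := by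
        ext e
        rw [side_eq_preimage, Set.mem_preimage, Set.mem_singleton_iff,
          ← Equiv.symm_apply_eq, Subtype.ext_iff]
        constructor
        · intro he
          rcases SimpleGraph.branch_subset_iUnion a b he with he | ⟨c, hc, hcb, -⟩
          · exact he
          · have hc : c ∈ D.tree.neighborSet a := hc
            rw [hx] at hc hb
            exact absurd (hc.trans hb.symm) hcb
        · intro he
          simp only at he
          rw [he]
          exact SimpleGraph.self_mem_branch a b
      rw [hside] at hbd ⊢
      exact .single _ hbd
    · have hside : ∀ e, e ∈ D.side a b ↔ ∃ c, D.tree.Adj a c ∧ c ≠ b ∧ e ∈ D.side c a := by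
        intro e
        constructor
        · intro he
          rcases SimpleGraph.branch_subset_iUnion a b he with he | he
          · exact absurd (he ▸ (D.leafEquiv.symm e).2) hleaf
          · exact he
        · rintro ⟨c, hc, hcb, he⟩
          exact hac.branch_subset_branch h hc hcb he
      have hcard : (D.tree.neighborSet a \ {b}).ncard ≤ 2 := by
        have := Set.ncard_sdiff_singleton_add_one hb
        have := D.subcubic a
        omega
      have hcard' : (D.tree.neighborSet a \ {b}).ncard ≠ 0 := by
        have := Set.ncard_sdiff_singleton_add_one hb
        omega
      have hmem : ∀ c, c ∈ D.tree.neighborSet a \ {b} ↔ D.tree.Adj a c ∧ c ≠ b := fun c => by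
        simp
      obtain hc | hc : (D.tree.neighborSet a \ {b}).ncard = 1 ∨
        (D.tree.neighborSet a \ {b}).ncard = 2 := by omega
      · obtain ⟨c, hc⟩ := Set.ncard_eq_one.1 hc
        have hcm := (hmem c).1 (by rw [hc]; rfl)
        have : D.side a b = D.side c a := by
          ext e
          rw [hside]
          refine ⟨?_, fun he => ⟨c, hcm.1, hcm.2, he⟩⟩
          rintro ⟨c', h1, h2, he⟩
          have : c' ∈ D.tree.neighborSet a \ {b} := (hmem c').2 ⟨h1, h2⟩
          rw [hc] at this
          rwa [Set.mem_singleton_iff.1 this] at he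
        rw [this]
        exact hstep c hcm.1 hcm.2
      · obtain ⟨c, c', hne, hc⟩ := Set.ncard_eq_two.1 hc
        have hcm := (hmem c).1 (by rw [hc]; simp)
        have hcm' := (hmem c').1 (by rw [hc]; simp)
        have : D.side a b = D.side c a ∪ D.side c' a := by
          ext e
          rw [hside]
          constructor
          · rintro ⟨x, h1, h2, he⟩
            have : x ∈ D.tree.neighborSet a \ {b} := (hmem x).2 ⟨h1, h2⟩
            rw [hc] at this
            rcases this with rfl | rfl
            · exact Or.inl he
            · exact Or.inr he
          · rintro (he | he)
            · exact ⟨c, hcm.1, hcm.2, he⟩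
            · exact ⟨c', hcm'.1, hcm'.2, he⟩
        rw [this] at hbd ⊢
        exact .union ((hac.disjoint_branch hcm.1 hcm'.1 hne).preimage _)
          (hstep c hcm.1 hcm.2) (hstep c' hcm'.1 hcm'.2) hbd

theorem branchDecomposable_univ (D : G.BranchDecomposition) :
    G.BranchDecomposable D.width Set.univ := by
  by_cases h : ∃ a b, D.tree.Adj a b
  · obtain ⟨a, b, h⟩ := h
    have hu : D.side a b ∪ D.side b a = Set.univ := by
      rw [D.side_swap h, Set.union_compl_self]
    rw [← hu]
    refine .union ?_ (D.branchDecomposable_side h) (D.branchDecomposable_side h.symm) ?_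
    · rw [D.side_swap h]
      exact disjoint_compl_right
    · rw [hu]
      simp
  -- A tree without edges has no leaves, so `G` has no edges.
  · push Not at h
    have : IsEmpty G.E := by
      refine ⟨fun e => ?_⟩
      obtain ⟨n, hn⟩ := D.leafEquiv.symm e
      obtain ⟨x, hx⟩ := Set.ncard_eq_one.1 hn
      have : x ∈ D.tree.neighborSet n := by rw [hx]; rfl
      exact h _ _ this
    rw [Set.univ_eq_empty_iff.2 this]
    exact .empty

end BranchDecomposition

end UGraph

/-! ### From recursive branch decompositions to trees -/

namespace UGraph

variable {G : UGraph.{u}}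

/-- A rooted subcubic tree that decomposes the set `A` of edges. The root counts as having one
more neighbour, to which it is going to be attached. -/
structure RootedDecomposition (G : UGraph.{u}) (k : ℕ) (A : Set G.E) where
  Node : Type u
  [finNode : Finite Node]
  tree : SimpleGraph Node
  root : Node
  leaf : G.E → Node
  connected : tree.Connected
  injOn : Set.InjOn leaf A
  -- The second summand is `1` at the root and `0` elsewhere: it counts the future neighbour of the
  -- root.
  isLeaf_iff : ∀ n, (tree.neighborSet n).ncard + {x | x = n ∧ x = root}.ncard = 1 ↔
    n ∈ leaf '' A
  subcubic : ∀ n, (tree.neighborSet n).ncard + {x | x = n ∧ x = root}.ncard ≤ 3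
  root_degree : (tree.neighborSet root).ncard = 2 ∨ A.ncard = 1
  -- The set `U` is the side of `ab` away from the root. It certifies that `ab` is a bridge and
  -- bounds the order of `ab`.
  cut : ∀ a b, tree.Adj a b → ∃ U : Set Node, root ∉ U ∧ (a ∈ U ↔ b ∉ U) ∧
    (∀ x ∈ U, ∀ y ∉ U, tree.Adj x y → s(x, y) = s(a, b)) ∧
    (G.boundary {e ∈ A | leaf e ∈ U}).ncard ≤ k

namespace RootedDecomposition

variable {k : ℕ}

theorem ncard_eq_root_self {N : Type*} (r : N) : {x | x = r ∧ x = r}.ncard = 1 := by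
  simp

theorem ncard_eq_root_of_ne {N : Type*} {n r : N} (h : n ≠ r) :
    {x | x = n ∧ x = r}.ncard = 0 := by
  have : {x | x = n ∧ x = r} = ∅ := by
    ext x
    simp only [Set.mem_ofPred_eq, Set.mem_empty_iff_false, iff_false]
    rintro ⟨rfl, h'⟩
    exact h h'
  rw [this, Set.ncard_empty]

/-- The rooted tree with a single node. -/
def single (e : G.E) : RootedDecomposition G k {e} where
  Node := PUnit
  tree := ⊥
  root := PUnit.unit
  leaf _ := PUnit.unit
  connected := SimpleGraph.IsTree.of_subsingleton.connected
  injOn := by simp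
  isLeaf_iff n := by simp
  subcubic n := by simp
  root_degree := Or.inr (by simp)
  cut a b h := by simp at h

/-- The tree obtained from two rooted trees by joining the roots to a new node. -/
def joinTree {N₁ N₂ : Type*} (T₁ : SimpleGraph N₁) (T₂ : SimpleGraph N₂) (r₁ : N₁) (r₂ : N₂) :
    SimpleGraph (Option (N₁ ⊕ N₂)) where
  Adj
    | none, none => False
    | none, some (Sum.inl b) => b = r₁
    | none, some (Sum.inr b) => b = r₂
    | some (Sum.inl a), none => a = r₁
    | some (Sum.inr a), none => a = r₂
    | some (Sum.inl a), some (Sum.inl b) => T₁.Adj a b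
    | some (Sum.inr a), some (Sum.inr b) => T₂.Adj a b
    | some (Sum.inl _), some (Sum.inr _) => False
    | some (Sum.inr _), some (Sum.inl _) => False
  symm := ⟨by
    rintro (_ | a | a) (_ | b | b) h
    all_goals first | exact h | exact SimpleGraph.Adj.symm h⟩
  loopless := ⟨by
    rintro (_ | a | a) h
    · exact h
    · exact T₁.loopless.irrefl a h
    · exact T₂.loopless.irrefl a h⟩

/-! ### Connectedness and degrees of the joined tree. -/

section joinTree

variable {N₁ N₂ : Type*} (T₁ : SimpleGraph N₁) (T₂ : SimpleGraph N₂) (r₁ : N₁) (r₂ : N₂)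

theorem joinTree_connected (h₁ : T₁.Connected) (h₂ : T₂.Connected) :
    (joinTree T₁ T₂ r₁ r₂).Connected := by
  have key : ∀ x, (joinTree T₁ T₂ r₁ r₂).Reachable x none := by
    rintro (_ | a | a)
    · exact SimpleGraph.Reachable.refl _
    · let φ : T₁ →g joinTree T₁ T₂ r₁ r₂ := ⟨fun a => some (Sum.inl a), fun h => h⟩
      exact ((h₁.preconnected a r₁).map φ).trans (SimpleGraph.Adj.reachable
        (show (joinTree T₁ T₂ r₁ r₂).Adj (some (Sum.inl r₁)) none from rfl))
    · let φ : T₂ →g joinTree T₁ T₂ r₁ r₂ := ⟨fun a => some (Sum.inr a), fun h => h⟩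
      exact ((h₂.preconnected a r₂).map φ).trans (SimpleGraph.Adj.reachable
        (show (joinTree T₁ T₂ r₁ r₂).Adj (some (Sum.inr r₂)) none from rfl))
  exact ⟨fun x y => (key x).trans (key y).symm⟩

theorem ncard_joinTree_none : ((joinTree T₁ T₂ r₁ r₂).neighborSet none).ncard = 2 := by
  have : (joinTree T₁ T₂ r₁ r₂).neighborSet none = {some (Sum.inl r₁), some (Sum.inr r₂)} := by
    ext (_ | a | a)
    · simp
    · simp [joinTree]
    · simp [joinTree]
  rw [this, Set.ncard_pair (by simp)]

/-- The new node is the neighbour that the indicator of the root had counted in advance, so the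
degree conditions carry over unchanged. -/
theorem ncard_joinTree_inl [Finite N₁] (n : N₁) :
    ((joinTree T₁ T₂ r₁ r₂).neighborSet (some (Sum.inl n))).ncard =
      (T₁.neighborSet n).ncard + {x | x = n ∧ x = r₁}.ncard := by
  have : (joinTree T₁ T₂ r₁ r₂).neighborSet (some (Sum.inl n)) =
      (fun a => some (Sum.inl a)) '' T₁.neighborSet n ∪
        (fun _ => none) '' {x | x = n ∧ x = r₁} := by
    ext (_ | a | a) <;> simp [joinTree]
  rw [this, Set.ncard_union_eq, Set.ncard_image_of_injective, Set.InjOn.ncard_image]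
  · rintro x ⟨rfl, -⟩ y ⟨rfl, -⟩ -
    rfl
  · intro x y h
    simpa using h
  · rw [Set.disjoint_left]
    rintro _ ⟨x, -, rfl⟩ ⟨y, -, h⟩
    cases h

theorem ncard_joinTree_inr [Finite N₂] (n : N₂) :
    ((joinTree T₁ T₂ r₁ r₂).neighborSet (some (Sum.inr n))).ncard =
      (T₂.neighborSet n).ncard + {x | x = n ∧ x = r₂}.ncard := by
  have : (joinTree T₁ T₂ r₁ r₂).neighborSet (some (Sum.inr n)) =
      (fun a => some (Sum.inr a)) '' T₂.neighborSet n ∪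
        (fun _ => none) '' {x | x = n ∧ x = r₂} := by
    ext (_ | a | a) <;> simp [joinTree]
  rw [this, Set.ncard_union_eq, Set.ncard_image_of_injective, Set.InjOn.ncard_image]
  · rintro x ⟨rfl, -⟩ y ⟨rfl, -⟩ -
    rfl
  · intro x y h
    simpa using h
  · rw [Set.disjoint_left]
    rintro _ ⟨x, -, rfl⟩ ⟨y, -, h⟩
    cases h

end joinTree

open Classical in
/-- Two rooted decompositions are joined by a new root. -/
noncomputable def join {A B : Set G.E} (hd : Disjoint A B) (hA : (G.boundary A).ncard ≤ k)
    (hB : (G.boundary B).ncard ≤ k) (D₁ : RootedDecomposition G k A)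
    (D₂ : RootedDecomposition G k B) : RootedDecomposition G k (A ∪ B) :=
  have := D₁.finNode
  have := D₂.finNode
  let leaf : G.E → Option (D₁.Node ⊕ D₂.Node) :=
    fun e => if e ∈ A then some (Sum.inl (D₁.leaf e)) else some (Sum.inr (D₂.leaf e))
  have leaf_left : ∀ e ∈ A, leaf e = some (Sum.inl (D₁.leaf e)) := fun e he => if_pos he
  have leaf_right : ∀ e ∈ B, leaf e = some (Sum.inr (D₂.leaf e)) := fun e he =>
    if_neg fun h => Set.disjoint_left.1 hd h he
  { Node := Option (D₁.Node ⊕ D₂.Node)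
    tree := joinTree D₁.tree D₂.tree D₁.root D₂.root
    root := none
    leaf := leaf
    connected := joinTree_connected _ _ _ _ D₁.connected D₂.connected
    injOn := by
      rintro e (he | he) e' (he' | he') h
      · rw [leaf_left _ he, leaf_left _ he'] at h
        exact D₁.injOn he he' (by simpa using h)
      · rw [leaf_left _ he, leaf_right _ he'] at h
        simp at h
      · rw [leaf_right _ he, leaf_left _ he'] at h
        simp at h
      · rw [leaf_right _ he, leaf_right _ he'] at h
        exact D₂.injOn he he' (by simpa using h)
    isLeaf_iff := by
      rintro (_ | n | n)
      · rw [ncard_joinTree_none]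
        refine ⟨by omega, ?_⟩
        rintro ⟨e, he | he, h⟩
        · rw [leaf_left _ he] at h
          cases h
        · rw [leaf_right _ he] at h
          cases h
      · rw [ncard_joinTree_inl, ncard_eq_root_of_ne (Option.some_ne_none (Sum.inl n)), add_zero, D₁.isLeaf_iff]
        constructor
        · rintro ⟨e, he, rfl⟩
          exact ⟨e, Or.inl he, leaf_left _ he⟩
        · rintro ⟨e, he | he, h⟩
          · rw [leaf_left _ he] at h
            exact ⟨e, he, by simpa using h⟩
          · rw [leaf_right _ he] at h
            simp at h
      · rw [ncard_joinTree_inr, ncard_eq_root_of_ne (Option.some_ne_none (Sum.inr n)), add_zero, D₂.isLeaf_iff]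
        constructor
        · rintro ⟨e, he, rfl⟩
          exact ⟨e, Or.inr he, leaf_right _ he⟩
        · rintro ⟨e, he | he, h⟩
          · rw [leaf_left _ he] at h
            simp at h
          · rw [leaf_right _ he] at h
            exact ⟨e, he, by simpa using h⟩
    subcubic := by
      rintro (_ | n | n)
      · rw [ncard_joinTree_none, ncard_eq_root_self]
      · rw [ncard_joinTree_inl, ncard_eq_root_of_ne (Option.some_ne_none (Sum.inl n))]
        exact D₁.subcubic n
      · rw [ncard_joinTree_inr, ncard_eq_root_of_ne (Option.some_ne_none (Sum.inr n))]
        exact D₂.subcubic n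
    root_degree := Or.inl (ncard_joinTree_none _ _ _ _)
    cut := by
      -- For the two new tree edges, `U` is the whole of one old tree, and the bound is that on the
      -- boundary of `A` or `B`.
      have hroot₁ : ∃ U : Set (Option (D₁.Node ⊕ D₂.Node)), none ∉ U ∧
          some (Sum.inl D₁.root) ∈ U ∧
          (∀ x ∈ U, ∀ y ∉ U, (joinTree D₁.tree D₂.tree D₁.root D₂.root).Adj x y →
            s(x, y) = s(some (Sum.inl D₁.root), none)) ∧
          (G.boundary {e ∈ A ∪ B | leaf e ∈ U}).ncard ≤ k := by
        refine ⟨Set.range fun a => some (Sum.inl a), by simp, by simp, ?_, ?_⟩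
        · rintro _ ⟨x, rfl⟩ (_ | y | y) hy h
          · rw [show x = D₁.root from h]
          · simp at hy
          · exact h.elim
        · have : {e ∈ A ∪ B | leaf e ∈ Set.range fun a => some (Sum.inl a)} = A := by
            ext e
            constructor
            · rintro ⟨he | he, a, h⟩
              · exact he
              · rw [leaf_right _ he] at h
                simp at h
            · intro he
              exact ⟨Or.inl he, _, (leaf_left _ he).symm⟩
          rwa [this]
      have hroot₂ : ∃ U : Set (Option (D₁.Node ⊕ D₂.Node)), none ∉ U ∧
          some (Sum.inr D₂.root) ∈ U ∧
          (∀ x ∈ U, ∀ y ∉ U, (joinTree D₁.tree D₂.tree D₁.root D₂.root).Adj x y →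
            s(x, y) = s(some (Sum.inr D₂.root), none)) ∧
          (G.boundary {e ∈ A ∪ B | leaf e ∈ U}).ncard ≤ k := by
        refine ⟨Set.range fun a => some (Sum.inr a), by simp, by simp, ?_, ?_⟩
        · rintro _ ⟨x, rfl⟩ (_ | y | y) hy h
          · rw [show x = D₂.root from h]
          · exact h.elim
          · simp at hy
        · have : {e ∈ A ∪ B | leaf e ∈ Set.range fun a => some (Sum.inr a)} = B := by
            ext e
            constructor
            · rintro ⟨he | he, a, h⟩
              · rw [leaf_left _ he] at h
                simp at h
              · exact he
            · intro he
              exact ⟨Or.inr he, _, (leaf_right _ he).symm⟩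
          rwa [this]
      rintro (_ | a | a) (_ | b | b) h
      · exact h.elim
      · obtain ⟨U, h1, h2, h3, h4⟩ := hroot₁
        obtain rfl : b = D₁.root := h
        exact ⟨U, h1, by tauto, by rwa [Sym2.eq_swap], h4⟩
      · obtain ⟨U, h1, h2, h3, h4⟩ := hroot₂
        obtain rfl : b = D₂.root := h
        exact ⟨U, h1, by tauto, by rwa [Sym2.eq_swap], h4⟩
      · obtain ⟨U, h1, h2, h3, h4⟩ := hroot₁
        obtain rfl : a = D₁.root := h
        exact ⟨U, h1, by tauto, h3, h4⟩
      · obtain ⟨U, h1, h2, h3, h4⟩ := D₁.cut a b h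
        have hmem : ∀ x, some (Sum.inl x) ∈
            (fun a => some (Sum.inl a) : D₁.Node → Option (D₁.Node ⊕ D₂.Node)) '' U ↔
            x ∈ U := by simp
        refine ⟨(fun a => some (Sum.inl a)) '' U, by simp, by rw [hmem, hmem]; exact h2, ?_, ?_⟩
        · rintro _ ⟨x, hx, rfl⟩ (_ | y | y) hy hxy
          -- The new node is adjacent to the old root only, which `U` avoids; so the old cut stays a
          -- cut.
          · exact absurd ((show x = D₁.root from hxy) ▸ hx) h1
          · rw [hmem] at hy
            exact congrArg (Sym2.map fun a => some (Sum.inl a)) (h3 x hx y hy hxy)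
          · exact hxy.elim
        · have : {e ∈ A ∪ B | leaf e ∈ (fun a => some (Sum.inl a)) '' U} =
              {e ∈ A | D₁.leaf e ∈ U} := by
            ext e
            constructor
            · rintro ⟨he | he, h⟩
              · rw [leaf_left _ he, hmem] at h
                exact ⟨he, h⟩
              · rw [leaf_right _ he] at h
                simp at h
            · rintro ⟨he, h⟩
              exact ⟨Or.inl he, _, h, (leaf_left _ he).symm⟩
          rwa [this]
      · exact h.elim
      · obtain ⟨U, h1, h2, h3, h4⟩ := hroot₂
        obtain rfl : a = D₂.root := h
        exact ⟨U, h1, by tauto, h3, h4⟩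
      · exact h.elim
      · obtain ⟨U, h1, h2, h3, h4⟩ := D₂.cut a b h
        have hmem : ∀ x, some (Sum.inr x) ∈
            (fun a => some (Sum.inr a) : D₂.Node → Option (D₁.Node ⊕ D₂.Node)) '' U ↔
            x ∈ U := by simp
        refine ⟨(fun a => some (Sum.inr a)) '' U, by simp, by rw [hmem, hmem]; exact h2, ?_, ?_⟩
        · rintro _ ⟨x, hx, rfl⟩ (_ | y | y) hy hxy
          · exact absurd ((show x = D₂.root from hxy) ▸ hx) h1
          · exact hxy.elim
          · rw [hmem] at hy
            exact congrArg (Sym2.map fun a => some (Sum.inr a)) (h3 x hx y hy hxy)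
        · have : {e ∈ A ∪ B | leaf e ∈ (fun a => some (Sum.inr a)) '' U} =
              {e ∈ B | D₂.leaf e ∈ U} := by
            ext e
            constructor
            · rintro ⟨he | he, h⟩
              · rw [leaf_left _ he] at h
                simp at h
              · rw [leaf_right _ he, hmem] at h
                exact ⟨he, h⟩
            · rintro ⟨he, h⟩
              exact ⟨Or.inr he, _, h, (leaf_right _ he).symm⟩
          rwa [this] }

/-- The component of the endpoint in `U` cannot leave `U`. Thus the cuts make every tree edge a
bridge, which gives acyclicity. -/
theorem not_reachable_of_cut {N : Type*} {T : SimpleGraph N} {a b : N} {U : Set N}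
    (h : a ∈ U ↔ b ∉ U) (hU : ∀ x ∈ U, ∀ y ∉ U, T.Adj x y → s(x, y) = s(a, b)) :
    ¬ (T.deleteEdges {s(a, b)}).Reachable a b := by
  intro hr
  by_cases ha : a ∈ U
  · exact h.1 ha (SimpleGraph.reachable_deleteEdges_subset ha hU hr)
  · have hb : b ∈ U := by tauto
    rw [Sym2.eq_swap] at hr hU
    exact ha (SimpleGraph.reachable_deleteEdges_subset hb hU hr.symm)

theorem isTree {A : Set G.E} (D : RootedDecomposition G k A) : D.tree.IsTree := by
  refine ⟨D.connected, SimpleGraph.isAcyclic_iff_forall_adj_isBridge.2 fun a b h => ?_⟩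
  obtain ⟨U, -, hab, hU, -⟩ := D.cut a b h
  exact not_reachable_of_cut hab hU

/-- A rooted decomposition of all edges of a graph with more than one edge is a branch
decomposition. -/
theorem exists_branchDecomposition (D : RootedDecomposition G k Set.univ)
    (hE : Nat.card G.E ≠ 1) : ∃ D' : G.BranchDecomposition, D'.width ≤ k := by
  have := D.finNode
  -- With degree two, the root does not become an extra leaf when its virtual neighbour is dropped;
  -- this is where the one-edge graph fails.
  have hroot : (D.tree.neighborSet D.root).ncard = 2 :=
    D.root_degree.resolve_right (by rwa [Set.ncard_univ])
  have hleaf : ∀ n, (D.tree.neighborSet n).ncard = 1 ↔ n ∈ Set.range D.leaf := by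
    intro n
    rw [← Set.image_univ, ← D.isLeaf_iff]
    by_cases h : n = D.root
    · subst h
      rw [hroot, ncard_eq_root_self]
      simp
    · rw [ncard_eq_root_of_ne h, add_zero]
  let D' : G.BranchDecomposition :=
    { Node := D.Node
      tree := D.tree
      isTree := D.isTree
      subcubic := fun n => le_trans (Nat.le_add_right _ _) (D.subcubic n)
      leafEquiv := (Equiv.subtypeEquivRight hleaf).trans
        (Equiv.ofInjective D.leaf (Set.injOn_univ.1 D.injOn)).symm }
  have hsymm : ∀ e, (D'.leafEquiv.symm e).1 = D.leaf e := fun e => rfl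
  refine ⟨D', ciSup_le' fun d => ?_⟩
  obtain ⟨⟨a, b⟩, h⟩ := d
  obtain ⟨U, -, hab, hU, hk⟩ := D.cut a b h
  -- The side of the endpoint in `U` lies in `U` and the other side in its complement. Which
  -- endpoint is in `U` is not known, hence the general `x` and `y`.
  have key : ∀ x y : D.Node, s(x, y) = s(a, b) → x ∈ U → y ∉ U →
      G.endpoints (D'.side x y) ∩ G.endpoints (D'.side y x) ⊆
        G.boundary {e ∈ Set.univ | D.leaf e ∈ U} := by
    intro x y hxy hx hy
    refine Set.inter_subset_inter (endpoints_mono fun e he => ?_) (endpoints_mono fun e he => ?_)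
    · exact ⟨trivial, SimpleGraph.reachable_deleteEdges_subset hx (hxy ▸ hU) he⟩
    · rintro ⟨-, hmem⟩
      refine SimpleGraph.reachable_deleteEdges_subset (U := Uᶜ) hy ?_ he hmem
      intro z hz w hw hzw
      rw [Sym2.eq_swap, Sym2.eq_swap (a := y), hxy]
      exact hU w (not_not.1 hw) z hz hzw.symm
  refine le_trans (Set.ncard_le_ncard ?_ (Set.toFinite _)) hk
  by_cases ha : a ∈ U
  · exact key a b rfl ha (hab.1 ha)
  · rw [Set.inter_comm]
    exact key b a Sym2.eq_swap (by tauto) ha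

end RootedDecomposition

/-- Empty parts have no tree of their own, so a union with an empty part is replaced by its other
part. -/
theorem BranchDecomposable.nonempty_rootedDecomposition {k : ℕ} {A : Set G.E}
    (h : G.BranchDecomposable k A) (hne : A.Nonempty) :
    Nonempty (RootedDecomposition G k A) := by
  induction h with
  | empty => exact absurd rfl hne.ne_empty
  | single e h => exact ⟨.single e⟩
  | @union A B hd hA hB h ihA ihB =>
    rcases A.eq_empty_or_nonempty with rfl | hA'
    · rw [Set.empty_union] at hne ⊢
      exact ihB hne
    rcases B.eq_empty_or_nonempty with rfl | hB'
    · rw [Set.union_empty] at hne ⊢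
      exact ihA hne
    obtain ⟨D₁⟩ := ihA hA'
    obtain ⟨D₂⟩ := ihB hB'
    exact ⟨D₁.join hd hA.ncard_boundary_le hB.ncard_boundary_le D₂⟩

theorem BranchDecomposable.exists_branchDecomposition {k : ℕ}
    (h : G.BranchDecomposable k Set.univ) (hE : Nat.card G.E ≠ 1) :
    ∃ D : G.BranchDecomposition, D.width ≤ k := by
  rcases isEmpty_or_nonempty G.E with hemp | hne
  · let D : G.BranchDecomposition :=
      { Node := PUnit
        tree := ⊥
        isTree := SimpleGraph.IsTree.of_subsingleton
        subcubic := by simp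
        leafEquiv := by
          haveI : IsEmpty {n : PUnit // ((⊥ : SimpleGraph PUnit).neighborSet n).ncard = 1} :=
            ⟨fun n => by simpa using n.2⟩
          exact Equiv.equivOfIsEmpty _ _ }
    refine ⟨D, ciSup_le' fun d => ?_⟩
    exact d.adj.elim
  · obtain ⟨D⟩ := h.nonempty_rootedDecomposition Set.univ_nonempty
    exact D.exists_branchDecomposition hE

theorem branchWidth_le_of_branchDecomposable {k : ℕ} (h : G.BranchDecomposable k Set.univ) :
    G.branchWidth ≤ k := by
  by_cases hE : Nat.card G.E = 1
  -- A tree with a leaf has at least two leaves, so no branch decomposition exists and the branch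
  -- width is `sInf ∅ = 0`.
  · have : IsEmpty G.BranchDecomposition := by
      refine ⟨fun D => ?_⟩
      have := D.finNode
      have hc : Nat.card {n : D.Node // (D.tree.neighborSet n).ncard = 1} = 1 := by
        rw [Nat.card_congr D.leafEquiv, hE]
      obtain ⟨⟨n, hn⟩, hu⟩ := (Nat.card_eq_one_iff_exists).1 hc
      classical
      have := Fintype.ofFinite D.Node
      have hnt : Nontrivial D.Node := by
        obtain ⟨x, hx⟩ := Set.ncard_eq_one.1 hn
        have hx : D.tree.Adj n x := (by rw [hx]; rfl : x ∈ D.tree.neighborSet n)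
        exact ⟨n, x, hx.ne⟩
      obtain ⟨x, y, hxy, hx, hy⟩ := D.isTree.exists_ne_and_degree_eq_one
      have conv : ∀ z, D.tree.degree z = 1 → (D.tree.neighborSet z).ncard = 1 := by
        intro z hz
        rw [← hz, ← SimpleGraph.card_neighborSet_eq_degree, Set.ncard_eq_toFinset_card',
          Set.toFinset_card]
      have h1 := hu ⟨x, conv x hx⟩
      have h2 := hu ⟨y, conv y hy⟩
      exact hxy (congrArg Subtype.val (h1.trans h2.symm))
    rw [branchWidth, Set.range_eq_empty, Nat.sInf_empty]
    exact Nat.zero_le _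
  · obtain ⟨D, hD⟩ := h.exists_branchDecomposition hE
    exact le_trans (Nat.sInf_le (Set.mem_range_self D)) hD

/-- The convention for one edge is consistent with the recursive notion, since the full edge set has
empty boundary. Otherwise the infimum is attained, because some decomposition exists. -/
theorem branchDecomposable_branchWidth (G : UGraph.{u}) :
    G.BranchDecomposable G.branchWidth Set.univ := by
  by_cases hE : Nat.card G.E = 1
  · obtain ⟨e, he⟩ := Nat.card_eq_one_iff_exists.1 hE
    have : (Set.univ : Set G.E) = {e} := by
      ext x
      simpa using he x
    have h0 : G.boundary {e} = ∅ := by rw [← this, boundary_univ]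
    rw [this]
    exact .single e (by simp [h0])
  · have h : G.BranchDecomposable (Nat.card G.V) Set.univ :=
      branchDecomposable_of_forall_subset fun B _ => Set.ncard_le_card _
    obtain ⟨D, -⟩ := h.exists_branchDecomposition hE
    have hne : (Set.range fun D : G.BranchDecomposition => D.width).Nonempty := ⟨_, D, rfl⟩
    obtain ⟨D, hD⟩ := Nat.sInf_mem hne
    rw [branchWidth, ← hD]
    exact D.branchDecomposable_univ

end UGraph

/-! ## Morphisms of bounded monoidal width -/

namespace DiscreteGraph

/-- The morphism has a monoidal decomposition of width at most `n`. -/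
def WidthLE (n : ℕ) {X Y : DiscreteGraph.{u}} (f : X ⟶ Y) : Prop :=
  ∃ d : MonoidalDecomposition (⊤ : MorphismProperty DiscreteGraph.{u}) f, d.width weight ≤ n

theorem exists_width_eq {X Y : DiscreteGraph.{u}} (f : X ⟶ Y) :
    ∃ d : MonoidalDecomposition (⊤ : MorphismProperty DiscreteGraph.{u}) f,
      d.width weight = monoidalWidth weight f := by
  have hne : (Set.range fun d : MonoidalDecomposition
      (⊤ : MorphismProperty DiscreteGraph.{u}) f => d.width weight).Nonempty :=
    ⟨_, MonoidalDecomposition.leaf f trivial, rfl⟩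
  exact Nat.sInf_mem hne

theorem WidthLE.monoidalWidth_le {n : ℕ} {X Y : DiscreteGraph.{u}} {f : X ⟶ Y}
    (h : WidthLE n f) : monoidalWidth weight f ≤ n := by
  obtain ⟨d, hd⟩ := h
  exact le_trans (Nat.sInf_le (Set.mem_range_self d)) hd

variable {n : ℕ} {X Y Z : DiscreteGraph.{u}}

theorem homMk_eq {f g : GraphCospan X.carrier Y.carrier} (h : f ≈ g) :
    (homMk f : X ⟶ Y) = homMk g := Quotient.sound h

theorem WidthLE.leaf (f : GraphCospan X.carrier Y.carrier) (h : Nat.card f.apex.V ≤ n) :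
    WidthLE n (homMk f : X ⟶ Y) := ⟨.leaf _ trivial, h⟩

theorem WidthLE.comp {f : GraphCospan X.carrier Y.carrier} {g : GraphCospan Y.carrier Z.carrier}
    (hf : WidthLE n (homMk f : X ⟶ Y)) (hg : WidthLE n (homMk g : Y ⟶ Z))
    (hY : Nat.card Y.carrier ≤ n) : WidthLE n (homMk (f.comp g) : X ⟶ Z) := by
  obtain ⟨d, hd⟩ := hf
  obtain ⟨d', hd'⟩ := hg
  exact ⟨.comp Y d d', max_le hd (max_le hY hd')⟩

theorem WidthLE.tensor {X' Y' : DiscreteGraph.{u}} {f : GraphCospan X.carrier Y.carrier}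
    {g : GraphCospan X'.carrier Y'.carrier} (hf : WidthLE n (homMk f : X ⟶ Y))
    (hg : WidthLE n (homMk g : X' ⟶ Y')) :
    WidthLE n (homMk (X := X ⊗ X') (Y := Y ⊗ Y') (f.tensor g)) := by
  obtain ⟨d, hd⟩ := hf
  obtain ⟨d', hd'⟩ := hg
  exact ⟨.tensor d d', max_le hd hd'⟩

theorem WidthLE.of_iso {f g : GraphCospan X.carrier Y.carrier}
    (hf : WidthLE n (homMk f : X ⟶ Y)) (h : f ≈ g) : WidthLE n (homMk g : X ⟶ Y) :=
  homMk_eq h ▸ hf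

/-- The cospan of `a` has apex `Y`, so the cost does not depend on `X`, and `a` may be any function.
On the right, a non-injective function would glue vertices; only bijections are used there. -/
theorem WidthLE.precomp {f : GraphCospan Y.carrier Z.carrier} (hf : WidthLE n (homMk f : Y ⟶ Z))
    (a : X.carrier → Y.carrier) (hY : Nat.card Y.carrier ≤ n) :
    WidthLE n (homMk ⟨f.apex, f.left ∘ a, f.right⟩ : X ⟶ Z) :=
  ((WidthLE.leaf (GraphCospan.ofFun a) hY).comp hf hY).of_iso (GraphCospan.ofFun_comp a f)

theorem WidthLE.postcomp {f : GraphCospan X.carrier Y.carrier} (hf : WidthLE n (homMk f : X ⟶ Y))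
    (b : Y.carrier ≃ Z.carrier) (hY : Nat.card Y.carrier ≤ n) :
    WidthLE n (homMk ⟨f.apex, f.left, f.right ∘ b.symm⟩ : X ⟶ Z) :=
  (hf.comp (WidthLE.leaf (GraphCospan.ofFun b) ((Nat.card_congr b).symm.trans_le hY)) hY).of_iso
    (GraphCospan.comp_ofFun f b)

/-- Copying one vertex of the left interface to the right interface. -/
theorem comp_copy {S Q : Type u} [Finite S] (f : GraphCospan S Q) (s : S) :
    GraphCospan.comp ⟨⟨S, PEmpty, fun e => e.elim⟩, id, Sum.elim id fun _ : PUnit.{u + 1} => s⟩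
      (f.tensor (GraphCospan.ofFun id)) ≈
    ⟨f.apex, f.left, Sum.elim f.right fun _ : PUnit.{u + 1} => f.left s⟩ := by
  let c : GraphCospan S (S ⊕ PUnit.{u + 1}) :=
    ⟨⟨S, PEmpty, fun e => e.elim⟩, id, Sum.elim id fun _ => s⟩
  let g : GraphCospan (S ⊕ PUnit.{u + 1}) (Q ⊕ PUnit.{u + 1}) :=
    f.tensor (GraphCospan.ofFun id)
  refine ⟨⟨GraphCospan.desc c g f.left (Sum.elim id fun _ => f.left s) ?_,
    fun v => Quot.mk _ (Sum.inr (Sum.inl v)), ?_, ?_⟩,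
    (Equiv.emptySum PEmpty _).trans (Equiv.sumEmpty _ PEmpty), ?_, ?_, ?_⟩
  · rintro (y | y) <;> rfl
  · rintro ⟨v | v | v⟩
    · exact (GraphCospan.glue_eq c g (Sum.inl v)).symm
    · rfl
    · exact (GraphCospan.glue_eq c g (Sum.inl s)).symm.trans
        (GraphCospan.glue_eq c g (Sum.inr v))
  · intro v
    rfl
  · rintro (e | e | e)
    · exact e.elim
    · exact (congrFun Sym2.map_id (f.apex.ends e)).symm.trans
        (GraphCospan.map_square₁ id _ _ _ (by intro _; rfl) _)
    · exact e.elim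
  · intro x
    rfl
  · rintro (y | y) <;> rfl

/-- Parts of the left interface can be copied to the right interface, vertex by vertex. -/
theorem WidthLE.copy {S : DiscreteGraph.{u}} (hS : Nat.card S.carrier + 1 ≤ n)
    {f : GraphCospan S.carrier PEmpty.{u + 1}}
    (hf : WidthLE n (homMk f : S ⟶ 𝟙_ DiscreteGraph.{u}))
    (Q : Type u) [hfin : Finite Q] (hQ : Nat.card Q ≤ n) (r : Q → S.carrier) :
    WidthLE n (homMk ⟨f.apex, f.left, f.left ∘ r⟩ : S ⟶ ⟨Q⟩) := by
  refine Finite.induction_empty_option (P := fun Q => ∀ (_ : Finite Q), Nat.card Q ≤ n →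
    ∀ r : Q → S.carrier, WidthLE n (homMk ⟨f.apex, f.left, f.left ∘ r⟩ : S ⟶ ⟨Q⟩))
    ?_ ?_ ?_ Q hfin hQ r
  · intro α β e ih hβ hcard r
    have : Finite α := Finite.of_equiv β e.symm
    have hα : Nat.card α ≤ n := by rwa [Nat.card_congr e]
    have := (ih inferInstance hα (r ∘ e)).postcomp (Z := ⟨β⟩) e hα
    convert this using 3
    funext y
    simp
  · intro _ _ r
    have : f.right = f.left ∘ r := funext fun x => x.elim
    rw [← this]
    exact hf
  · intro α _ ih _ hcard r
    have : Finite α := inferInstance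
    have hα : Nat.card α + 1 ≤ n := by rwa [Finite.card_option] at hcard
    have h1 := ih inferInstance (by omega) (r ∘ some)
    have h2 : WidthLE n (homMk (GraphCospan.ofFun id) :
        (⟨PUnit⟩ : DiscreteGraph.{u}) ⟶ ⟨PUnit⟩) :=
      WidthLE.leaf _ (by
        change Nat.card PUnit ≤ n
        simp only [Nat.card_unique]
        omega)
    -- The vertex `r none` is duplicated, then `f` acts beside an identity wire. The composition
    -- along `S ⊗ ⟨PUnit⟩` is the source of the `+ 1` in the upper bound.
    have h3 : WidthLE n (homMk ⟨⟨S.carrier, PEmpty, fun e => e.elim⟩, id,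
        Sum.elim id fun _ : PUnit.{u + 1} => r none⟩ : S ⟶ S ⊗ (⟨PUnit⟩ : DiscreteGraph.{u})) :=
      WidthLE.leaf _ (by
        change Nat.card S.carrier ≤ n
        omega)
    have h4 := (h3.comp (h1.tensor h2) (by
      change Nat.card (S.carrier ⊕ PUnit) ≤ n
      simpa using hS)).of_iso (comp_copy _ _)
    have h5 := h4.postcomp (Z := ⟨Option α⟩) (Equiv.optionEquivSumPUnit α).symm (by
      change Nat.card (α ⊕ PUnit) ≤ n
      simpa using hα)
    convert h5 using 3
    funext y
    cases y <;> rfl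

end DiscreteGraph

/-! ## Pieces of a graph -/

namespace UGraph

open DiscreteGraph

/-- A cospan is a copy of the part of `G` with vertices `W` and edges `A`, with legs `l` and `r`. -/
def IsCopy (G : UGraph.{u}) {X Y : Type u} (f : GraphCospan X Y) (W : Set G.V) (A : Set G.E)
    (l : X → G.V) (r : Y → G.V) : Prop :=
  ∃ (φ : f.apex.V → G.V) (ψ : f.apex.E → G.E), Function.Injective φ ∧ Function.Injective ψ ∧
    Set.range φ = W ∧ Set.range ψ = A ∧ (∀ e, G.ends (ψ e) = (f.apex.ends e).map φ) ∧
    (∀ x, φ (f.left x) = l x) ∧ (∀ y, φ (f.right y) = r y)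

/-- The part of `G` with vertices `W` and edges `A`, with legs `l` and `r`, has monoidal width at
most `n`. -/
def PieceWidthLE (G : UGraph.{u}) (n : ℕ) (W : Set G.V) (A : Set G.E) {X Y : DiscreteGraph.{u}}
    (l : X.carrier → G.V) (r : Y.carrier → G.V) : Prop :=
  ∃ f : GraphCospan X.carrier Y.carrier, G.IsCopy f W A l r ∧ WidthLE n (homMk f : X ⟶ Y)

variable {G : UGraph.{u}} {n : ℕ}

theorem sym2_map_eq {α β γ : Type*} (p : α → β) (q : β → γ) (r : α → γ)
    (h : ∀ a, r a = q (p a)) (s : Sym2 α) : s.map r = (s.map p).map q := by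
  rw [Sym2.map_map, show q ∘ p = r from (funext h).symm]

theorem exists_isCopy {X Y : Type u} {W : Set G.V} {A : Set G.E} {l : X → G.V} {r : Y → G.V}
    (hA : G.endpoints A ⊆ W) (hl : ∀ x, l x ∈ W) (hr : ∀ y, r y ∈ W) :
    ∃ f : GraphCospan X Y, G.IsCopy f W A l r ∧ Nat.card f.apex.V = W.ncard := by
  refine ⟨⟨⟨W, A, fun e => (G.ends e).attachWith fun v hv => hA ⟨e, e.2, hv⟩⟩,
    fun x => ⟨l x, hl x⟩, fun y => ⟨r y, hr y⟩⟩,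
    ⟨Subtype.val, Subtype.val, Subtype.val_injective, Subtype.val_injective,
      Subtype.range_val, Subtype.range_val, fun e => ?_, fun _ => rfl, fun _ => rfl⟩, rfl⟩
  exact (Sym2.attachWith_map_subtypeVal _).symm

variable {X Y Z : DiscreteGraph.{u}}

theorem PieceWidthLE.leaf {W : Set G.V} {A : Set G.E} {l : X.carrier → G.V}
    {r : Y.carrier → G.V} (hA : G.endpoints A ⊆ W) (hl : ∀ x, l x ∈ W) (hr : ∀ y, r y ∈ W)
    (hW : W.ncard ≤ n) : G.PieceWidthLE n W A l r := by
  obtain ⟨f, hf, hc⟩ := exists_isCopy hA hl hr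
  exact ⟨f, hf, WidthLE.leaf f (hc ▸ hW)⟩

/-- The hypothesis `hW` says that every vertex common to the two parts is glued, so the pushout
still embeds in `G`. -/
theorem PieceWidthLE.comp {W₁ W₂ : Set G.V} {A₁ A₂ : Set G.E} {l : X.carrier → G.V}
    {m : Y.carrier → G.V} {r : Z.carrier → G.V} (h₁ : G.PieceWidthLE n W₁ A₁ l m)
    (h₂ : G.PieceWidthLE n W₂ A₂ m r) (hA : Disjoint A₁ A₂) (hW : W₁ ∩ W₂ ⊆ Set.range m)
    (hY : Nat.card Y.carrier ≤ n) : G.PieceWidthLE n (W₁ ∪ W₂) (A₁ ∪ A₂) l r := by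
  obtain ⟨f, ⟨φ, ψ, hφ, hψ, rfl, rfl, he, hl, hm⟩, hf⟩ := h₁
  obtain ⟨g, ⟨φ', ψ', hφ', hψ', rfl, rfl, he', hm', hr⟩, hg⟩ := h₂
  have hglue : ∀ v w, φ v = φ' w →
      (Quot.mk _ (Sum.inl v) : GraphCospan.CompV f g) = Quot.mk _ (Sum.inr w) := by
    intro v w h
    obtain ⟨y, hy⟩ := hW ⟨⟨v, rfl⟩, ⟨w, h.symm⟩⟩
    obtain rfl : f.right y = v := hφ ((hm y).trans hy)
    obtain rfl : g.left y = w := hφ' ((hm' y).trans (hy.trans h))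
    exact GraphCospan.glue_eq f g y
  refine ⟨f.comp g, ⟨GraphCospan.desc f g φ φ' fun y => (hm y).trans (hm' y).symm,
    Sum.elim ψ ψ', ?_, ?_, ?_, Set.Sum.elim_range _ _, ?_, hl, hr⟩, hf.comp hg hY⟩
  · rintro ⟨v | v⟩ ⟨w | w⟩ h
    · rw [hφ h]
    · exact hglue v w h
    · exact (hglue w v h.symm).symm
    · rw [hφ' h]
  · refine hψ.sumElim hψ' fun a b h => ?_
    exact Set.disjoint_left.1 hA ⟨a, rfl⟩ ⟨b, h.symm⟩
  · ext v
    constructor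
    · rintro ⟨⟨x | x⟩, rfl⟩
      · exact Or.inl ⟨x, rfl⟩
      · exact Or.inr ⟨x, rfl⟩
    · rintro (⟨x, rfl⟩ | ⟨x, rfl⟩)
      · exact ⟨Quot.mk _ (Sum.inl x), rfl⟩
      · exact ⟨Quot.mk _ (Sum.inr x), rfl⟩
  · rintro (e | e)
    · exact (he e).trans (sym2_map_eq _ _ _ (by intro _; rfl) _)
    · exact (he' e).trans (sym2_map_eq _ _ _ (by intro _; rfl) _)

theorem PieceWidthLE.tensor {X' Y' : DiscreteGraph.{u}} {W₁ W₂ : Set G.V} {A₁ A₂ : Set G.E}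
    {l : X.carrier → G.V} {r : Y.carrier → G.V} {l' : X'.carrier → G.V} {r' : Y'.carrier → G.V}
    (h₁ : G.PieceWidthLE n W₁ A₁ l r) (h₂ : G.PieceWidthLE n W₂ A₂ l' r')
    (hA : Disjoint A₁ A₂) (hW : Disjoint W₁ W₂) :
    G.PieceWidthLE n (W₁ ∪ W₂) (A₁ ∪ A₂) (X := X ⊗ X') (Y := Y ⊗ Y') (Sum.elim l l')
      (Sum.elim r r') := by
  obtain ⟨f, ⟨φ, ψ, hφ, hψ, rfl, rfl, he, hl, hr⟩, hf⟩ := h₁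
  obtain ⟨g, ⟨φ', ψ', hφ', hψ', rfl, rfl, he', hl', hr'⟩, hg⟩ := h₂
  refine ⟨f.tensor g, ⟨Sum.elim φ φ', Sum.elim ψ ψ', ?_, ?_, Set.Sum.elim_range _ _,
    Set.Sum.elim_range _ _, ?_, ?_, ?_⟩, hf.tensor hg⟩
  · refine hφ.sumElim hφ' fun a b h => ?_
    exact Set.disjoint_left.1 hW ⟨a, rfl⟩ ⟨b, h.symm⟩
  · refine hψ.sumElim hψ' fun a b h => ?_
    exact Set.disjoint_left.1 hA ⟨a, rfl⟩ ⟨b, h.symm⟩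
  · rintro (e | e)
    · exact (he e).trans (sym2_map_eq _ _ _ (by intro _; rfl) _)
    · exact (he' e).trans (sym2_map_eq _ _ _ (by intro _; rfl) _)
  · rintro (x | x)
    · exact hl x
    · exact hl' x
  · rintro (x | x)
    · exact hr x
    · exact hr' x

theorem PieceWidthLE.relabel_left {W : Set G.V} {A : Set G.E} {l : X.carrier → G.V}
    {r : Y.carrier → G.V} (h : G.PieceWidthLE n W A l r) (hX : Nat.card X.carrier ≤ n)
    {X' : DiscreteGraph.{u}} {l' : X'.carrier → G.V} (hl : Set.range l' ⊆ Set.range l) :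
    G.PieceWidthLE n W A l' r := by
  obtain ⟨f, ⟨φ, ψ, hφ, hψ, hW, hA, he, hl', hr⟩, hf⟩ := h
  choose a ha using fun x => hl ⟨x, rfl⟩
  exact ⟨_, ⟨φ, ψ, hφ, hψ, hW, hA, he, fun x => (hl' _).trans (ha x), hr⟩, hf.precomp a hX⟩

theorem PieceWidthLE.relabel_right {W : Set G.V} {A : Set G.E} {l : X.carrier → G.V}
    {r : Y.carrier → G.V} (h : G.PieceWidthLE n W A l r) (hY : Nat.card Y.carrier ≤ n)
    {Y' : DiscreteGraph.{u}} {r' : Y'.carrier → G.V} (hr : Function.Injective r)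
    (hr' : Function.Injective r') (hrange : Set.range r = Set.range r') :
    G.PieceWidthLE n W A l r' := by
  obtain ⟨f, ⟨φ, ψ, hφ, hψ, hW, hA, he, hl, hfr⟩, hf⟩ := h
  let b : Y.carrier ≃ Y'.carrier := (Equiv.ofInjective r hr).trans
    ((Equiv.setCongr hrange).trans (Equiv.ofInjective r' hr').symm)
  have hb : ∀ y, r' (b y) = r y := fun y => Equiv.apply_ofInjective_symm hr' _
  refine ⟨_, ⟨φ, ψ, hφ, hψ, hW, hA, he, hl, fun y => ?_⟩, hf.postcomp b hY⟩
  refine (hfr _).trans ?_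
  rw [← hb, Equiv.apply_symm_apply]

/-- Any vertices on the left interface may be exposed on the right as well, and those not wanted on
the left are dropped. -/
theorem PieceWidthLE.bend {W : Set G.V} {A : Set G.E} {l : X.carrier → G.V}
    {r : PEmpty.{u + 1} → G.V} (h : G.PieceWidthLE n W A l (Y := 𝟙_ DiscreteGraph.{u}) r)
    (hX : Nat.card X.carrier + 1 ≤ n) {P Q : DiscreteGraph.{u}} {p : P.carrier → G.V}
    {q : Q.carrier → G.V} (hp : Set.range p ⊆ Set.range l) (hq : Set.range q ⊆ Set.range l)
    (hQ : Nat.card Q.carrier ≤ n) : G.PieceWidthLE n W A p q := by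
  obtain ⟨f, ⟨φ, ψ, hφ, hψ, hW, hA, he, hl, hr⟩, hf⟩ := h
  choose b hb using fun y => hq ⟨y, rfl⟩
  refine PieceWidthLE.relabel_left (l := l) ?_ (by omega) hp
  exact ⟨_, ⟨φ, ψ, hφ, hψ, hW, hA, he, hl, fun y => (hl _).trans (hb y)⟩,
    hf.copy hX Q.carrier hQ b⟩

/-! ### The upper bound. -/

theorem boundary_union_subset {A B : Set G.E} :
    G.boundary (A ∪ B) ⊆ G.boundary A ∪ G.boundary B := by
  rintro v ⟨hv, hv'⟩
  rw [endpoints_union] at hv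
  rcases hv with hv | hv
  · exact Or.inl ⟨hv, endpoints_mono (Set.compl_subset_compl.2 Set.subset_union_left) hv'⟩
  · exact Or.inr ⟨hv, endpoints_mono (Set.compl_subset_compl.2 Set.subset_union_right) hv'⟩

/-- A vertex of `∂B` outside `∂A` meets no edge of `A`, so its edge outside `B` is also outside `A ∪
B`. The wires that bypass `A` therefore agree at both ends. -/
theorem boundary_sdiff_boundary {A B : Set G.E} (hd : Disjoint A B) :
    G.boundary (A ∪ B) \ G.boundary A = G.boundary B \ G.boundary A := by
  ext v
  constructor
  · rintro ⟨hv, hA⟩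
    exact ⟨(boundary_union_subset hv).resolve_left hA, hA⟩
  · rintro ⟨⟨⟨e, he, hev⟩, ⟨e', he', hev'⟩⟩, hA⟩
    refine ⟨⟨⟨e, Or.inr he, hev⟩, e', fun h => ?_, hev'⟩, hA⟩
    rcases h with h | h
    · exact hA ⟨⟨e', h, hev'⟩, ⟨e, fun h' => Set.disjoint_left.1 hd h' he, hev⟩⟩
    · exact he' h

/-- The effect given by a branch decomposable set of edges has small monoidal width. -/
theorem BranchDecomposable.pieceWidthLE {k : ℕ} {A : Set G.E} (h : G.BranchDecomposable k A)
    (hk : k + 1 ≤ n) (hn : ∀ e, (G.endpoints {e}).ncard ≤ n) :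
    G.PieceWidthLE n (G.endpoints A) A (X := ⟨G.boundary A⟩) (Y := 𝟙_ DiscreteGraph.{u})
      Subtype.val PEmpty.elim := by
  induction h with
  | empty =>
    refine .leaf le_rfl (fun x => x.2.1) (fun y => y.elim) ?_
    simp
  | single e h => exact .leaf le_rfl (fun x => x.2.1) (fun y => y.elim) (hn e)
  | @union A B hd hA hB h ihA ihB =>
    have hbA := hA.ncard_boundary_le
    have hbB := hB.ncard_boundary_le
    set S := G.boundary (A ∪ B) with hS
    set SA := G.boundary A with hSA
    set SB := G.boundary B with hSB
    have hdiff : S \ SA = SB \ SA := boundary_sdiff_boundary hd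
    have hcard : ∀ C D : Set G.V, (C ∩ D).ncard + (C \ D).ncard = C.ncard := fun C D =>
      Set.ncard_inter_add_ncard_sdiff_eq_ncard C D
    have hrange : ∀ C D : Set G.V,
        Set.range (Sum.elim Subtype.val Subtype.val : ↥(C ∩ D) ⊕ ↥(C \ D) → G.V) = C := by
      intro C D
      rw [Set.Sum.elim_range, Subtype.range_val, Subtype.range_val, Set.inter_union_sdiff]
    have hcS := hcard S SA
    have hcSB := hcard SB SA
    -- The piece of `A` takes in the part of `S` on its boundary and puts out the vertices it shares
    -- with `SB`.
    have h1 : G.PieceWidthLE n (G.endpoints A) A (X := ⟨↥(S ∩ SA)⟩) (Y := ⟨↥(SB ∩ SA)⟩)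
        Subtype.val Subtype.val := by
      refine ihA.bend ?_ ?_ ?_ ?_
      · change SA.ncard + 1 ≤ n
        omega
      · simp
      · simp
      · change (SB ∩ SA).ncard ≤ n
        omega
    -- The rest of `S` runs past `A` as identity wires, since `S \ SA = SB \ SA`.
    have h2 : G.PieceWidthLE n (S \ SA) ∅ (X := ⟨↥(S \ SA)⟩) (Y := ⟨↥(SB \ SA)⟩)
        Subtype.val Subtype.val := by
      refine .leaf (by simp) (fun x => x.2) (fun y => hdiff.symm.le y.2) ?_
      omega
    -- A vertex of `S` meets an edge outside `A ∪ B`, so if it were an endpoint of `A` it would lie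
    -- in `SA`.
    have hdisj : Disjoint (G.endpoints A) (S \ SA) := by
      rw [Set.disjoint_left]
      rintro v hv ⟨⟨-, e, he, hev⟩, hvA⟩
      exact hvA ⟨hv, e, fun h => he (Or.inl h), hev⟩
    have h3 := h1.tensor h2 (Set.disjoint_empty _) hdisj
    have h4 : G.PieceWidthLE n (G.endpoints A ∪ S \ SA) (A ∪ ∅) (X := ⟨S⟩) (Y := ⟨SB⟩)
        Subtype.val Subtype.val := by
      refine (h3.relabel_left (X' := ⟨S⟩) (l' := Subtype.val) ?_ ?_).relabel_right
        (Y' := ⟨SB⟩) (r' := Subtype.val) ?_ ?_ Subtype.val_injective ?_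
      · change Nat.card (↥(S ∩ SA) ⊕ ↥(S \ SA)) ≤ n
        rw [Nat.card_sum]
        change (S ∩ SA).ncard + (S \ SA).ncard ≤ n
        omega
      · exact (Subtype.range_val.trans (hrange S SA).symm).le
      · change Nat.card (↥(SB ∩ SA) ⊕ ↥(SB \ SA)) ≤ n
        rw [Nat.card_sum]
        change (SB ∩ SA).ncard + (SB \ SA).ncard ≤ n
        omega
      · refine Subtype.val_injective.sumElim Subtype.val_injective fun a b hab => ?_
        exact b.2.2 (hab ▸ a.2.2)
      · exact (hrange SB SA).trans Subtype.range_val.symm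
    rw [Set.union_empty] at h4
    -- Glueing along `SB` suffices: an endpoint of both `A` and `B` lies on the boundary of `B`.
    have h5 := h4.comp ihB hd (by
      rw [Subtype.range_val]
      rintro v ⟨hv | hv, hvB⟩
      · obtain ⟨e, he, hev⟩ := hv
        exact ⟨hvB, e, fun h' => Set.disjoint_left.1 hd he h', hev⟩
      · rw [hdiff] at hv
        exact hv.1) (by
      change SB.ncard ≤ n
      omega)
    convert h5 using 1
    rw [endpoints_union, hdiff, Set.union_assoc,
      Set.union_eq_self_of_subset_left (s := SB \ SA) fun v hv => hv.1.1]

/-- Vertices are added one at a time by composition along `∅`, so their number does not matter. -/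
theorem pieceWidthLE_isolated (hn : 1 ≤ n) (W : Set G.V) :
    G.PieceWidthLE n W ∅ (X := 𝟙_ DiscreteGraph.{u}) (Y := 𝟙_ DiscreteGraph.{u})
      PEmpty.elim PEmpty.elim := by
  induction W, Set.toFinite W using Set.Finite.induction_on with
  | empty => exact .leaf (by simp) (fun x => x.elim) (fun x => x.elim) (by simp)
  | @insert v W hv _ ih =>
    have h : G.PieceWidthLE n {v} ∅ (X := 𝟙_ DiscreteGraph.{u}) (Y := 𝟙_ DiscreteGraph.{u})
        PEmpty.elim PEmpty.elim :=
      .leaf (by simp) (fun x => x.elim) (fun x => x.elim) (by simpa using hn)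
    have := h.comp ih (Set.disjoint_empty _) (by
      rintro x ⟨rfl, hx⟩
      exact absurd hx hv) (by
      change Nat.card PEmpty ≤ n
      simp)
    rwa [Set.union_empty, ← Set.insert_eq] at this

/-- The cost of bending and the cost of single edges are separate hypotheses, so that the excepted
case is covered with `n = 2`. -/
theorem monoidalWidth_toHom_le (hbw : G.branchWidth + 1 ≤ n)
    (hn : ∀ e, (G.endpoints {e}).ncard ≤ n) :
    monoidalWidth DiscreteGraph.weight G.toHom ≤ n := by
  have h1 := G.branchDecomposable_branchWidth.pieceWidthLE hbw hn
  have h2 : G.PieceWidthLE n (G.endpoints Set.univ) Set.univ (X := 𝟙_ DiscreteGraph.{u})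
      (Y := 𝟙_ DiscreteGraph.{u}) PEmpty.elim PEmpty.elim := by
    refine h1.relabel_left ?_ ?_
    · change (G.boundary Set.univ).ncard ≤ n
      simp
    · rintro _ ⟨x, -⟩
      exact x.elim
  have h3 := h2.comp (pieceWidthLE_isolated (by omega) (G.endpoints Set.univ)ᶜ)
    (Set.disjoint_empty _) (by simp) (by
      change Nat.card PEmpty ≤ n
      simp)
  rw [Set.union_empty, Set.union_compl_self] at h3
  obtain ⟨f, ⟨φ, ψ, hφ, hψ, hφ', hψ', he, -, -⟩, hf⟩ := h3
  refine (hf.of_iso ?_).monoidalWidth_le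
  exact ⟨Equiv.ofBijective φ ⟨hφ, Set.range_eq_univ.1 hφ'⟩,
    Equiv.ofBijective ψ ⟨hψ, Set.range_eq_univ.1 hψ'⟩, he, fun x => x.elim, fun x => x.elim⟩

end UGraph

/-! ## Lower bounds for the monoidal width -/

namespace GraphCospan

variable {X Y Z X' Y' : Type u}

/-- The vertices in the images of the legs. -/
def interface (f : GraphCospan X Y) : Set f.apex.V := Set.range f.left ∪ Set.range f.right

/-- Here and in the next three lemmas, a predicate compatible with the glueing descends to the
pushout and tells vertices apart: only vertices in the glued leg are ever identified with another
vertex. -/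
theorem mem_range_right_of_mk_eq {f : GraphCospan X Y} {g : GraphCospan Y Z} {v : f.apex.V}
    {w : g.apex.V}
    (h : (Quot.mk _ (Sum.inl v) : CompV f g) = Quot.mk _ (Sum.inr w)) :
    v ∈ Set.range f.right := by
  have := congrArg (Quot.lift (Sum.elim (fun v => v ∈ Set.range f.right) fun _ => True)
    (by rintro _ _ ⟨y⟩; simp)) h
  exact this.symm.mp trivial

theorem mem_range_left_of_mk_eq {f : GraphCospan X Y} {g : GraphCospan Y Z} {v : f.apex.V}
    {w : g.apex.V}
    (h : (Quot.mk _ (Sum.inl v) : CompV f g) = Quot.mk _ (Sum.inr w)) :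
    w ∈ Set.range g.left := by
  have := congrArg (Quot.lift (Sum.elim (fun _ => True) fun w => w ∈ Set.range g.left)
    (by rintro _ _ ⟨y⟩; simp)) h
  exact this.mp trivial

theorem mem_range_right_of_mk_inl_eq {f : GraphCospan X Y} {g : GraphCospan Y Z}
    {v v' : f.apex.V} (h : (Quot.mk _ (Sum.inl v) : CompV f g) = Quot.mk _ (Sum.inl v'))
    (hne : v ≠ v') : v ∈ Set.range f.right := by
  by_contra hv
  have := congrArg (Quot.lift (Sum.elim (fun w => w = v) fun _ => False) (by
    rintro _ _ ⟨y⟩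
    simp only [Sum.elim_inl, Sum.elim_inr, eq_iff_iff, iff_false]
    exact fun h => hv ⟨y, h⟩)) h
  exact hne (this.mp rfl).symm

theorem mem_range_left_of_mk_inr_eq {f : GraphCospan X Y} {g : GraphCospan Y Z}
    {v v' : g.apex.V} (h : (Quot.mk _ (Sum.inr v) : CompV f g) = Quot.mk _ (Sum.inr v'))
    (hne : v ≠ v') : v ∈ Set.range g.left := by
  by_contra hv
  have := congrArg (Quot.lift (Sum.elim (fun _ => False) fun w => w = v) (by
    rintro _ _ ⟨y⟩
    simp only [Sum.elim_inl, Sum.elim_inr, eq_iff_iff, false_iff]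
    exact fun h => hv ⟨y, h⟩)) h
  exact hne (this.mp rfl).symm

/-- A part of `G` that has the shape of the apex of `f` and is attached to the rest of `G` along
the interface of `f` only. -/
structure Placement (f : GraphCospan X Y) (G : UGraph.{u}) where
  vert : f.apex.V → G.V
  edge : f.apex.E → G.E
  edge_injective : Function.Injective edge
  ends_edge : ∀ e, G.ends (edge e) = (f.apex.ends e).map vert
  -- Injectivity is not required: glueing elsewhere in `G` may identify interface vertices of the
  -- piece.
  mem_of_eq : ∀ v w, vert v = vert w → v ≠ w → v ∈ f.interface
  mem_of_outside : ∀ v, ∀ e ∉ Set.range edge, vert v ∈ G.ends e → v ∈ f.interface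

namespace Placement

variable {G : UGraph.{u}}

theorem exists_mem_ends {f : GraphCospan X Y} (p : f.Placement G) {v : G.V} {e : f.apex.E}
    (h : v ∈ G.ends (p.edge e)) : ∃ w ∈ f.apex.ends e, p.vert w = v := by
  rwa [p.ends_edge, Sym2.mem_map] at h

theorem mem_endpoints {f : GraphCospan X Y} (p : f.Placement G) {v : G.V}
    (h : v ∈ G.endpoints (Set.range p.edge)) : ∃ x, p.vert x = v := by
  obtain ⟨_, ⟨e, rfl⟩, hv⟩ := h
  obtain ⟨x, -, hx⟩ := p.exists_mem_ends hv
  exact ⟨x, hx⟩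

/-- The boundary is covered by the images of both legs; this is the origin of the factor `2`. -/
theorem ncard_boundary_le [Finite X] [Finite Y] {f : GraphCospan X Y} (p : f.Placement G) :
    (G.boundary (Set.range p.edge)).ncard ≤ Nat.card X + Nat.card Y := by
  have hsub : G.boundary (Set.range p.edge) ⊆
      Set.range (p.vert ∘ Sum.elim f.left f.right) := by
    rintro v ⟨hv, e, he, hev⟩
    obtain ⟨x, rfl⟩ := p.mem_endpoints hv
    rcases p.mem_of_outside x e he hev with ⟨y, rfl⟩ | ⟨y, rfl⟩
    · exact ⟨Sum.inl y, rfl⟩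
    · exact ⟨Sum.inr y, rfl⟩
  refine (Set.ncard_le_ncard hsub (Set.toFinite _)).trans ?_
  rw [← Nat.card_sum]
  exact Finite.card_range_le _

theorem branchDecomposable_of_card_le {f : GraphCospan X Y} (p : f.Placement G) {k : ℕ}
    (h : Nat.card f.apex.V ≤ k) : G.BranchDecomposable k (Set.range p.edge) := by
  refine UGraph.branchDecomposable_of_forall_subset fun B hB => ?_
  have hsub : G.boundary B ⊆ Set.range p.vert := fun v hv =>
    p.mem_endpoints (UGraph.endpoints_mono hB hv.1)
  exact (Set.ncard_le_ncard hsub (Set.toFinite _)).trans ((Finite.card_range_le _).trans h)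

/-! ### Restricting a placement to the factors of a composite or a product. -/

section comp

variable {f : GraphCospan X Y} {g : GraphCospan Y Z}

theorem mem_interface_left {v : f.apex.V}
    (h : (Quot.mk _ (Sum.inl v) : CompV f g) ∈ (f.comp g).interface) : v ∈ f.interface := by
  rcases h with ⟨x, hx⟩ | ⟨z, hz⟩
  · by_cases hv : v = f.left x
    · exact Or.inl ⟨x, hv.symm⟩
    · exact Or.inr (mem_range_right_of_mk_inl_eq hx.symm hv)
  · exact Or.inr (mem_range_right_of_mk_eq hz.symm)

theorem mem_interface_right {v : g.apex.V}
    (h : (Quot.mk _ (Sum.inr v) : CompV f g) ∈ (f.comp g).interface) : v ∈ g.interface := by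
  rcases h with ⟨x, hx⟩ | ⟨z, hz⟩
  · exact Or.inl (mem_range_left_of_mk_eq hx)
  · by_cases hv : v = g.right z
    · exact Or.inr ⟨z, hv.symm⟩
    · exact Or.inl (mem_range_left_of_mk_inr_eq hz.symm hv)

/-- The first part of a placed composite. -/
def compLeft (p : (f.comp g).Placement G) : f.Placement G where
  vert v := p.vert (Quot.mk _ (Sum.inl v))
  edge e := p.edge (Sum.inl e)
  edge_injective _ _ h := Sum.inl_injective (p.edge_injective h)
  ends_edge e := (p.ends_edge (Sum.inl e)).trans (Sym2.map_map _)
  mem_of_eq v w h hne := by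
    by_cases h' : (Quot.mk _ (Sum.inl v) : CompV f g) = Quot.mk _ (Sum.inl w)
    · exact Or.inr (mem_range_right_of_mk_inl_eq h' hne)
    · exact mem_interface_left (p.mem_of_eq _ _ h h')
  mem_of_outside v e he hv := by
    by_cases h : e ∈ Set.range p.edge
    · obtain ⟨e | e, rfl⟩ := h
      · exact absurd ⟨e, rfl⟩ he
      -- The edge belongs to `g`. Either `v` is glued to its end `w'` in the pushout, or the two
      -- meet only in `G`, through the interface of the composite.
      · obtain ⟨w, hw, hvw⟩ := p.exists_mem_ends hv
        obtain ⟨w', -, rfl⟩ := Sym2.mem_map.1 hw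
        by_cases h' : (Quot.mk _ (Sum.inl v) : CompV f g) = Quot.mk _ (Sum.inr w')
        · exact Or.inr (mem_range_right_of_mk_eq h')
        · exact mem_interface_left (p.mem_of_eq _ _ hvw.symm h')
    · exact mem_interface_left (p.mem_of_outside _ e h hv)

/-- The second part of a placed composite. -/
def compRight (p : (f.comp g).Placement G) : g.Placement G where
  vert v := p.vert (Quot.mk _ (Sum.inr v))
  edge e := p.edge (Sum.inr e)
  edge_injective _ _ h := Sum.inr_injective (p.edge_injective h)
  ends_edge e := (p.ends_edge (Sum.inr e)).trans (Sym2.map_map _)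
  mem_of_eq v w h hne := by
    by_cases h' : (Quot.mk _ (Sum.inr v) : CompV f g) = Quot.mk _ (Sum.inr w)
    · exact Or.inl (mem_range_left_of_mk_inr_eq h' hne)
    · exact mem_interface_right (p.mem_of_eq _ _ h h')
  mem_of_outside v e he hv := by
    by_cases h : e ∈ Set.range p.edge
    · obtain ⟨e | e, rfl⟩ := h
      · obtain ⟨w, hw, hvw⟩ := p.exists_mem_ends hv
        obtain ⟨w', -, rfl⟩ := Sym2.mem_map.1 hw
        by_cases h' : (Quot.mk _ (Sum.inl w') : CompV f g) = Quot.mk _ (Sum.inr v)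
        · exact Or.inl (mem_range_left_of_mk_eq h')
        · exact mem_interface_right (p.mem_of_eq _ _ hvw.symm (Ne.symm h'))
      · exact absurd ⟨e, rfl⟩ he
    · exact mem_interface_right (p.mem_of_outside _ e h hv)

end comp

section tensor

variable {f : GraphCospan X Y} {g : GraphCospan X' Y'}

theorem mem_interface_inl {v : f.apex.V} (h : Sum.inl v ∈ (f.tensor g).interface) :
    v ∈ f.interface := by
  rcases h with ⟨x | x, hx⟩ | ⟨x | x, hx⟩
  · exact Or.inl ⟨x, Sum.inl_injective hx⟩
  · cases hx
  · exact Or.inr ⟨x, Sum.inl_injective hx⟩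
  · cases hx

theorem mem_interface_inr {v : g.apex.V} (h : Sum.inr v ∈ (f.tensor g).interface) :
    v ∈ g.interface := by
  rcases h with ⟨x | x, hx⟩ | ⟨x | x, hx⟩
  · cases hx
  · exact Or.inl ⟨x, Sum.inr_injective hx⟩
  · cases hx
  · exact Or.inr ⟨x, Sum.inr_injective hx⟩

/-- The first part of a placed disjoint union. -/
def tensorLeft (p : (f.tensor g).Placement G) : f.Placement G where
  vert v := p.vert (Sum.inl v)
  edge e := p.edge (Sum.inl e)
  edge_injective _ _ h := Sum.inl_injective (p.edge_injective h)
  ends_edge e := (p.ends_edge (Sum.inl e)).trans (Sym2.map_map _)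
  mem_of_eq v w h hne :=
    mem_interface_inl (p.mem_of_eq _ _ h fun h' => hne (Sum.inl_injective h'))
  mem_of_outside v e he hv := by
    by_cases h : e ∈ Set.range p.edge
    · obtain ⟨e | e, rfl⟩ := h
      · exact absurd ⟨e, rfl⟩ he
      · obtain ⟨w, hw, hvw⟩ := p.exists_mem_ends hv
        obtain ⟨w', -, rfl⟩ := Sym2.mem_map.1 hw
        exact mem_interface_inl (p.mem_of_eq _ _ hvw.symm Sum.inl_ne_inr)
    · exact mem_interface_inl (p.mem_of_outside _ e h hv)

/-- The second part of a placed disjoint union. -/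
def tensorRight (p : (f.tensor g).Placement G) : g.Placement G where
  vert v := p.vert (Sum.inr v)
  edge e := p.edge (Sum.inr e)
  edge_injective _ _ h := Sum.inr_injective (p.edge_injective h)
  ends_edge e := (p.ends_edge (Sum.inr e)).trans (Sym2.map_map _)
  mem_of_eq v w h hne :=
    mem_interface_inr (p.mem_of_eq _ _ h fun h' => hne (Sum.inr_injective h'))
  mem_of_outside v e he hv := by
    by_cases h : e ∈ Set.range p.edge
    · obtain ⟨e | e, rfl⟩ := h
      · obtain ⟨w, hw, hvw⟩ := p.exists_mem_ends hv
        obtain ⟨w', -, rfl⟩ := Sym2.mem_map.1 hw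
        exact mem_interface_inr (p.mem_of_eq _ _ hvw.symm Sum.inr_ne_inl)
      · exact absurd ⟨e, rfl⟩ he
    · exact mem_interface_inr (p.mem_of_outside _ e h hv)

end tensor

end Placement

end GraphCospan

/-! ### Induction on monoidal decompositions. -/

namespace DiscreteGraph

open GraphCospan

/-- The bound on both ends survives: at `≫` the middle object is bounded by its weight, at `⊗` the
ends only shrink. The cospan is chosen along `d`, since morphisms are isomorphism classes, so that
the edges of a node are literally the sum of those of its children. -/
theorem exists_cospan_branchDecomposable {X Y : DiscreteGraph.{u}} {f : X ⟶ Y}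
    (d : MonoidalDecomposition (⊤ : MorphismProperty DiscreteGraph.{u}) f) :
    ∃ c : GraphCospan X.carrier Y.carrier, homMk c = f ∧ ∀ w : ℕ, d.width weight ≤ w →
      Nat.card X.carrier ≤ w → Nat.card Y.carrier ≤ w →
      ∀ (G : UGraph.{u}) (p : c.Placement G),
        G.BranchDecomposable (2 * w) (Set.range p.edge) := by
  induction d with
  | leaf f _ =>
    obtain ⟨c, rfl⟩ := Quotient.exists_rep f
    refine ⟨c, rfl, fun w hw _ _ G p => p.branchDecomposable_of_card_le ?_⟩
    have : Nat.card c.apex.V ≤ w := hw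
    omega
  | @tensor A₁ B₁ A₂ B₂ f₁ f₂ d₁ d₂ ih₁ ih₂ =>
    obtain ⟨c₁, rfl, h₁⟩ := ih₁
    obtain ⟨c₂, rfl, h₂⟩ := ih₂
    refine ⟨c₁.tensor c₂, rfl, fun w hw hX hY G p => ?_⟩
    have hX' : Nat.card A₁.carrier + Nat.card A₂.carrier ≤ w := by
      rw [← Nat.card_sum]
      exact hX
    have hY' : Nat.card B₁.carrier + Nat.card B₂.carrier ≤ w := by
      rw [← Nat.card_sum]
      exact hY
    have hrange : Set.range p.edge =
        Set.range p.tensorLeft.edge ∪ Set.range p.tensorRight.edge := by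
      ext e
      exact Sum.exists
    have hb := Placement.ncard_boundary_le (X := A₁.carrier ⊕ A₂.carrier)
      (Y := B₁.carrier ⊕ B₂.carrier) p
    rw [Nat.card_sum, Nat.card_sum] at hb
    rw [hrange] at hb ⊢
    refine .union ?_ (h₁ w ((le_max_left _ _).trans hw) (by omega) (by omega) G _)
      (h₂ w ((le_max_right _ _).trans hw) (by omega) (by omega) G _) (by omega)
    rw [Set.disjoint_left]
    rintro _ ⟨a, rfl⟩ ⟨b, hb⟩
    cases p.edge_injective hb
  | @comp A B X f₁ f₂ d₁ d₂ ih₁ ih₂ =>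
    obtain ⟨c₁, rfl, h₁⟩ := ih₁
    obtain ⟨c₂, rfl, h₂⟩ := ih₂
    refine ⟨c₁.comp c₂, rfl, fun w hw hA hB G p => ?_⟩
    have hw₁ : d₁.width weight ≤ w := (le_max_left _ _).trans hw
    have hw₂ : d₂.width weight ≤ w :=
      (le_max_right _ _).trans ((le_max_right _ _).trans hw)
    have hX : Nat.card X.carrier ≤ w :=
      (le_max_left _ _).trans ((le_max_right _ _).trans hw)
    have hrange : Set.range p.edge =
        Set.range p.compLeft.edge ∪ Set.range p.compRight.edge := by
      ext e
      exact Sum.exists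
    have hb := p.ncard_boundary_le
    rw [hrange] at hb ⊢
    refine .union ?_ (h₁ w hw₁ hA hX G _) (h₂ w hw₂ hX hB G _) (by omega)
    rw [Set.disjoint_left]
    rintro _ ⟨a, rfl⟩ ⟨b, hb⟩
    cases p.edge_injective hb

/-- Maps of vertices send loops to loops, so a non-loop comes from a non-loop in some leaf, whose
apex then has two vertices. -/
theorem exists_cospan_two_le_width {X Y : DiscreteGraph.{u}} {f : X ⟶ Y}
    (d : MonoidalDecomposition (⊤ : MorphismProperty DiscreteGraph.{u}) f) :
    ∃ c : GraphCospan X.carrier Y.carrier, homMk c = f ∧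
      ((∃ e, ¬ (c.apex.ends e).IsDiag) → 2 ≤ d.width weight) := by
  induction d with
  | leaf f _ =>
    obtain ⟨c, rfl⟩ := Quotient.exists_rep f
    refine ⟨c, rfl, ?_⟩
    rintro ⟨e, he⟩
    change 1 < Nat.card c.apex.V
    induction h : c.apex.ends e with
    | _ x y =>
      rw [h] at he
      rw [Finite.one_lt_card_iff_nontrivial]
      exact ⟨x, y, he⟩
  | tensor d₁ d₂ ih₁ ih₂ =>
    obtain ⟨c₁, rfl, h₁⟩ := ih₁
    obtain ⟨c₂, rfl, h₂⟩ := ih₂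
    refine ⟨c₁.tensor c₂, rfl, ?_⟩
    rintro ⟨e | e, he⟩
    · exact (h₁ ⟨e, fun h => he h.map⟩).trans (le_max_left _ _)
    · exact (h₂ ⟨e, fun h => he h.map⟩).trans (le_max_right _ _)
  | comp X d₁ d₂ ih₁ ih₂ =>
    obtain ⟨c₁, rfl, h₁⟩ := ih₁
    obtain ⟨c₂, rfl, h₂⟩ := ih₂
    refine ⟨c₁.comp c₂, rfl, ?_⟩
    rintro ⟨e | e, he⟩
    · exact (h₁ ⟨e, fun h => he h.map⟩).trans (le_max_left _ _)
    · exact (h₂ ⟨e, fun h => he h.map⟩).trans ((le_max_right _ _).trans (le_max_right _ _))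

end DiscreteGraph

/-! ### The bounds for a graph and the theorem. -/

namespace UGraph

open DiscreteGraph GraphCospan

variable {G : UGraph.{u}}

theorem branchWidth_le_two_mul_monoidalWidth (G : UGraph.{u}) :
    G.branchWidth ≤ 2 * monoidalWidth DiscreteGraph.weight G.toHom := by
  obtain ⟨d, hd⟩ := exists_width_eq G.toHom
  obtain ⟨c, hc, h⟩ := exists_cospan_branchDecomposable d
  obtain ⟨φ, ψ, he, -, -⟩ := Quotient.exact hc
  have h0 : Nat.card (𝟙_ DiscreteGraph.{u}).carrier = 0 := by
    change Nat.card PEmpty = 0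
    simp
  have hψ : Set.range ψ = Set.univ := ψ.range_eq_univ
  -- The isomorphism places the cospan as all of `G`: it is injective and leaves no edge outside, so
  -- both interface conditions are vacuous.
  have := h _ hd.le (by omega) (by omega) G
    { vert := φ
      edge := ψ
      edge_injective := ψ.injective
      ends_edge := he
      mem_of_eq := fun v w h hne => absurd (φ.injective h) hne
      mem_of_outside := fun v e he => absurd (hψ ▸ Set.mem_univ e) he }
  exact branchWidth_le_of_branchDecomposable (hψ ▸ this)

theorem two_le_monoidalWidth (e : G.E) (h : ¬ (G.ends e).IsDiag) :
    2 ≤ monoidalWidth DiscreteGraph.weight G.toHom := by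
  obtain ⟨d, hd⟩ := exists_width_eq G.toHom
  obtain ⟨c, hc, h'⟩ := exists_cospan_two_le_width d
  obtain ⟨φ, ψ, he, -, -⟩ := Quotient.exact hc
  rw [← hd]
  refine h' ⟨ψ.symm e, fun hdiag => h ?_⟩
  have := he (ψ.symm e)
  rw [Equiv.apply_symm_apply] at this
  exact this ▸ hdiag.map

theorem endpoints_singleton (e : G.E) : G.endpoints {e} = {v | v ∈ G.ends e} := by
  ext v
  simp [endpoints]

theorem ncard_endpoints_singleton_le (e : G.E) : (G.endpoints {e}).ncard ≤ 2 := by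
  rw [endpoints_singleton]
  induction G.ends e with
  | _ x y =>
    have : {v | v ∈ s(x, y)} = {x, y} := by ext v; simp
    rw [this]
    exact Set.ncard_insert_le _ _ |>.trans (by simp)

theorem ncard_endpoints_singleton_le_one {e : G.E} (h : (G.ends e).IsDiag) :
    (G.endpoints {e}).ncard ≤ 1 := by
  rw [endpoints_singleton]
  induction he : G.ends e with
  | _ x y =>
    rw [he] at h
    obtain rfl : x = y := h
    have : {v | v ∈ s(x, x)} = {x} := by ext v; simp
    rw [this, Set.ncard_singleton]

end UGraph

theorem mainTheorem3 (G : UGraph.{u}) :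
    (1 / 2 : ℝ) * G.branchWidth ≤ monoidalWidth DiscreteGraph.weight G.toHom ∧
    ((G.branchWidth = 0 → ∀ e : G.E, (G.ends e).IsDiag) →
      monoidalWidth DiscreteGraph.weight G.toHom ≤ G.branchWidth + 1) ∧
    (G.branchWidth = 0 → (∃ e : G.E, ¬ (G.ends e).IsDiag) →
      monoidalWidth DiscreteGraph.weight G.toHom = 2) := by
  refine ⟨?_, fun h => ?_, fun h0 ⟨e, he⟩ => le_antisymm ?_ (UGraph.two_le_monoidalWidth e he)⟩
  · have h : (G.branchWidth : ℝ) ≤ 2 * monoidalWidth DiscreteGraph.weight G.toHom := by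
      exact_mod_cast G.branchWidth_le_two_mul_monoidalWidth
    linarith
  · refine UGraph.monoidalWidth_toHom_le le_rfl fun e => ?_
    -- For branch width `0` all edges are loops with one endpoint; otherwise `G.branchWidth + 1` is
    -- at least `2`.
    by_cases h0 : G.branchWidth = 0
    · have := UGraph.ncard_endpoints_singleton_le_one (h h0 e)
      omega
    · have := UGraph.ncard_endpoints_singleton_le e
      omega
  · exact UGraph.monoidalWidth_toHom_le (by omega) UGraph.ncard_endpoints_singleton_le
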